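/- Let $G$ be a finite-dimensional Lie group with Lie algebra $\mathfrak g$, and let $L:TG\to\mathbb R$ be a smooth Lagrangian whose Legendre transform $\mathbb FL:TG\to T^*G$, $(g,v)\mapsto(g,\frac{\partial L}{\partial v}(g,v))$, is a diffeomorphism. Write $\ell(g,\xi)=L(g,g\xi)$ for the left-trivialized Lagrangian on $G\times\mathfrak g$, and let $$\mathcal I_{HP}=\{(g,v,p)\in TG\oplus T^*G : p=\tfrac{\partial L}{\partial v}(g,v)\},\qquad \mathcal I_{hp}=\{(g,\xi,\mu)\in G\times\mathfrak g\times\mathfrak g^* : \mu=\tfrac{\partial \ell}{\partial\xi}(g,\xi)\}.$$ Let $\pi_{\mathcal I_{HP}}:\mathcal I_{HP}\to T^*G$ be the restriction of $(g,v,p)\mapsto(g,p)$, let $\phi_{\mathcal I_{hp}}:\mathcal I_{hp}\to\mathcal I_{HP}$ be the restriction of the left trivialization $(g,\xi,\mu)\mapsto(g,g\xi,g\mu)$, where $\langle g\mu,v\rangle=\langle\mu,g^{-1}v\rangle$, let $\Omega=\mathbf d\Theta$ be the canonical symplectic form of $T^*G$ ($\Theta$ the canonical one-form), and set $$\omega_{\mathcal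 I_{hp}}=\phi_{\mathcal I_{hp}}^*\,\pi_{\mathcal I_{HP}}^*\,\Omega .$$ For $a\le b$ let $D\subseteq\mathcal I_{hp}$ be the set of initial conditions $(g(a),\xi(a),\mu(a))$ for which the left-trivialized Hamilton--Pontryagin equations $$\dot g=g\xi,\qquad \dot\mu=\operatorname{ad}^*_\xi\mu+g\,\frac{\partial\ell}{\partial g}(g,\xi),\qquad \mu=\frac{\partial\ell}{\partial\xi}(g,\xi)$$ have a solution on all of $[a,b]$, where $\langle\operatorname{ad}^*_\xi\mu,\eta\rangle=\langle\mu,[\xi,\eta]\rangle$ and $\langle g\frac{\partial\ell}{\partial g},\eta\rangle=\langle\frac{\partial\ell}{\partial g},g\eta\rangle$. Then the end point $(g(b),\xi(b),\mu(b))$ of such a solution is determined by its initial point, so that the left-trivialized HP flow map $F_{hp}:D\to\mathcal I_{hp}$, $(g(a),\xi(a),\mu(a))\mapsto(g(b),\xi(b),\mu(b))$, is well defined; $D$ is open in $\mathcal I_{hp}$, $F_{hp}$ is differentiable on $D$, and $$(F_{hp})^*\,\omega_{\mathcal I_{hp}}=\omega_{\mathcal I_{hp}}\quad\text{on } D .$$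 -/

import Mathlib

open Set Bundle
open scoped Manifold ContDiff

namespace HPFlow
noncomputable section

section Transport
variable {E : Type*} [NormedAddCommGroup E] [NormedSpace ℝ E]
  {H : Type*} [TopologicalSpace H] {I : ModelWithCorners ℝ E H}
  {X M : Type*} [TopologicalSpace X] [TopologicalSpace M] [ChartedSpace H M]

/-- The charts of `M` transported to `X` along a homeomorphism `X ≃ₜ M`. -/
@[reducible] def transportedCharts (e : X ≃ₜ M) : ChartedSpace H X where
  atlas := {c | ∃ c' ∈ atlas H M, c = e.transOpenPartialHomeomorph c'}
  chartAt x := e.transOpenPartialHomeomorph (chartAt H (e x))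
  mem_chart_source x := by simp
  chart_mem_atlas x := ⟨_, chart_mem_atlas H (e x), rfl⟩

theorem transportedCharts_isManifold [IsManifold I ∞ M] (e : X ≃ₜ M) :
    @IsManifold ℝ _ E _ _ H _ I ∞ X _ (transportedCharts e) := by
  let _ : ChartedSpace H X := transportedCharts e
  refine isManifold_of_contDiffOn I ∞ X ?_
  rintro _ _ ⟨c, hc, rfl⟩ ⟨c', hc', rfl⟩
  have h := ((mem_groupoid_of_pregroupoid).1
    ((contDiffGroupoid ∞ I).compatible hc hc')).1
  simp only [contDiffPregroupoid] at h
  convert! h using 1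
  · ext y; simp
  · ext y; simp

theorem contMDiff_transported (e : X ≃ₜ M) :
    @ContMDiff ℝ _ E _ _ H _ I X _ (transportedCharts e) E _ _ H _ I M _ _ ∞ e := by
  let _ : ChartedSpace H X := transportedCharts e
  intro x
  rw [contMDiffAt_iff]
  refine ⟨e.continuous.continuousAt, ?_⟩
  convert! (contMDiffAt_iff.1 (contMDiffAt_id (I := I) (n := ∞) (x := e x))).2 using 1
  ext y
  change I (chartAt H (e x) (e (e.symm ((chartAt H (e x)).symm (I.symm y))))) =
    I (chartAt H (e x) ((chartAt H (e x)).symm (I.symm y)))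
  rw [e.apply_symm_apply]

theorem contMDiff_transported_symm (e : X ≃ₜ M)  :
    @ContMDiff ℝ _ E _ _ H _ I M _ _ E _ _ H _ I X _ (transportedCharts e) ∞ e.symm := by
  let _ : ChartedSpace H X := transportedCharts e
  intro x
  rw [contMDiffAt_iff]
  refine ⟨e.symm.continuous.continuousAt, ?_⟩
  convert! (contMDiffAt_iff.1 (contMDiffAt_id (I := I) (n := ∞) (x := x))).2 using 1
  ext y
  change I (chartAt H (e (e.symm x)) (e (e.symm ((chartAt H x).symm (I.symm y))))) =
    I (chartAt H x ((chartAt H x).symm (I.symm y)))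
  rw [e.apply_symm_apply, e.apply_symm_apply]

end Transport

section Forms
variable {E : Type*} [NormedAddCommGroup E] [NormedSpace ℝ E]
  {H : Type*} [TopologicalSpace H] (I : ModelWithCorners ℝ E H)
  {E' : Type*} [NormedAddCommGroup E'] [NormedSpace ℝ E']
  {H' : Type*} [TopologicalSpace H'] (I' : ModelWithCorners ℝ E' H')
  (M : Type*) [TopologicalSpace M] [ChartedSpace H M]
  {N : Type*} [TopologicalSpace N] [ChartedSpace H' N] {k : ℕ}

/-- Differential `k`-forms on a manifold, as families of alternating forms on the tangent spaces. -/
abbrev DiffForm (k : ℕ) : Type _ := ∀ x : M, TangentSpace I x [⋀^Fin k]→L[ℝ] ℝ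

variable {M}

/-- The pullback `f^* α` of a differential form. -/
def formPullback (f : M → N) (α : DiffForm I' N k) : DiffForm I M k :=
  fun x => (α (f x)).compContinuousLinearMap (mfderiv I I' f x)

/-- The exterior derivative of a differential form on a manifold, computed at `x` in the preferred
chart at `x`: pull the form back to the model space, differentiate there, and pull back to `M`. -/
def exteriorDerivative (α : DiffForm I M k) : DiffForm I M (k + 1) := fun x =>
  (extDerivWithin
    (fun y : E => ((α ((extChartAt I x).symm y)).compContinuousLinearMap
      (mfderivWithin 𝓘(ℝ, E) I (extChartAt I x).symm (range I) y) : E [⋀^Fin k]→L[ℝ] ℝ))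
    (range I) (extChartAt I x x)).compContinuousLinearMap
      (mfderiv I 𝓘(ℝ, E) (extChartAt I x) x)

end Forms

section
variable {E : Type*} [NormedAddCommGroup E] [NormedSpace ℝ E]
  {H : Type*} [TopologicalSpace H] {I : ModelWithCorners ℝ E H}
  {G : Type*} [TopologicalSpace G] [ChartedSpace H G]
variable (I G) in
/-- The cotangent bundle `T*G`. -/
abbrev CotangentBundle : Type _ := TotalSpace (E →L[ℝ] ℝ) (fun g : G => TangentSpace I g →L[ℝ] ℝ)
variable (I G) in
/-- The Whitney sum `TG ⊕ T*G`, with elements `(g, (v, p))`. -/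
abbrev PontryaginBundle : Type _ := TotalSpace (E × (E →L[ℝ] ℝ)) (fun g : G => TangentSpace I g × (TangentSpace I g →L[ℝ] ℝ))

variable (I G) in
/-- Smooth Lagrangians `L : TG → ℝ`. -/
abbrev Lagrangian [IsManifold I ∞ G] : Type _ := C^∞⟮I.tangent, TangentBundle I G; 𝓘(ℝ, ℝ), ℝ⟯

variable [Group G]

variable (I) in
/-- `ξ ↦ g ξ`, the derivative at the identity of left translation by `g`. Here `GroupLieAlgebra I G`
is the tangent space of `G` at the identity, which is by definition the model space `E`. -/
def leftMul (g : G) : GroupLieAlgebra I G →L[ℝ] TangentSpace I g :=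
  mfderiv I I (fun h : G => g * h) 1
variable (I) in
/-- `v ↦ g⁻¹ v`, the derivative at `g` of left translation by `g⁻¹`. -/
def leftMulInv (g : G) : TangentSpace I g →L[ℝ] GroupLieAlgebra I G :=
  mfderiv I I (fun h : G => g⁻¹ * h) g

variable [LieGroup I ∞ G]

theorem leftMul_leftMulInv (g : G) (v : TangentSpace I g) :
    leftMul I g (leftMulInv I g v) = v := by
  have h1 : MDifferentiableAt I I (fun h : G => g⁻¹ * h) g :=
    (contMDiff_mul_left (n := ∞)).mdifferentiableAt (by simp)
  have h2 : MDifferentiableAt I I (fun h : G => g * h) (g⁻¹ * g) :=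
    (contMDiff_mul_left (n := ∞)).mdifferentiableAt (by simp)
  have h3 := mfderiv_comp g h2 h1
  have h4 : (fun h : G => g * h) ∘ (fun h : G => g⁻¹ * h) = id := by ext; simp
  rw [h4, mfderiv_id] at h3
  have h5 := congrArg (fun f : E →L[ℝ] E => f v) h3
  have key : ∀ x : G, x = 1 → ∀ w : E,
    (mfderiv I I (fun h : G => g * h) x : E →L[ℝ] E) w = (mfderiv I I (fun h : G => g * h) 1 : E →L[ℝ] E) w := by
    rintro x rfl w; rfl
  exact (key (g⁻¹ * g) (by simp) _).symm.trans (Eq.symm h5)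

theorem leftMulInv_leftMul (g : G) (v : GroupLieAlgebra I G) :
    leftMulInv I g (leftMul I g v) = v := by
  have h1 : MDifferentiableAt I I (fun h : G => g⁻¹ * h) (g * 1) :=
    (contMDiff_mul_left (n := ∞)).mdifferentiableAt (by simp)
  have h2 : MDifferentiableAt I I (fun h : G => g * h) 1 :=
    (contMDiff_mul_left (n := ∞)).mdifferentiableAt (by simp)
  have h3 := mfderiv_comp 1 h1 h2
  have h4 : (fun h : G => g⁻¹ * h) ∘ (fun h : G => g * h) = id := by ext; simp
  rw [h4, mfderiv_id] at h3
  have h5 := congrArg (fun f : E →L[ℝ] E => f v) h3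
  have key : ∀ x : G, x = g → ∀ w : E,
    (mfderiv I I (fun h : G => g⁻¹ * h) x : E →L[ℝ] E) w = (mfderiv I I (fun h : G => g⁻¹ * h) g : E →L[ℝ] E) w := by
    rintro x rfl w; rfl
  exact (key (g * 1) (by simp) _).symm.trans (Eq.symm h5)

theorem trivializationAt_self_snd (g : G) (v : E) :
    (trivializationAt E (TangentSpace I) g (⟨g, v⟩ : TangentBundle I G)).2 = v :=
  (tangentBundleCore I G).coordChange_self (achart H g) g (mem_chart_source H g) v

theorem contMDiff_leftMul : ContMDiff (I.prod 𝓘(ℝ, E)) I.tangent ∞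
    (fun p : G × E => (⟨p.1, leftMul I p.1 p.2⟩ : TangentBundle I G)) := by
  intro p₀
  have hϕ := ContMDiffAt.mfderiv (I := I) (I' := I)
    (J := I.prod 𝓘(ℝ, E)) (m := ∞) (n := ∞) (x₀ := p₀)
    (fun (p : G × E) (h : G) => p.1 * h) (fun _ => 1)
    ((contMDiff_fst.fst.mul contMDiff_snd).contMDiffAt) contMDiffAt_const (by simp)
  have e : (fun p : G × E => p.1 * 1) = fun p => p.1 := by ext; simp
  rw [e] at hϕ
  refine ContMDiffAt.clm_apply_of_inCoordinates (M := G × E) (IM := I.prod 𝓘(ℝ, E)) (b₁ := fun _ : G × E => (1 : G)) (b₂ := fun p => p.1)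
    (ϕ := fun p => leftMul I p.1) (v := fun p => p.2) (IB₁ := I) hϕ ?_ contMDiffAt_fst
  rw [contMDiffAt_totalSpace]
  refine ⟨contMDiffAt_const, ?_⟩
  convert! (contMDiffAt_snd : ContMDiffAt (I.prod 𝓘(ℝ, E)) 𝓘(ℝ, E) ∞ _ p₀) using 1
  ext p
  exact trivializationAt_self_snd 1 p.2

theorem contMDiff_leftMulInv : ContMDiff I.tangent (I.prod 𝓘(ℝ, E)) ∞
    (fun x : TangentBundle I G => ((x.1, leftMulInv I x.1 x.2) : G × E)) := by
  intro p₀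
  have hϕ := ContMDiffAt.mfderiv (I := I) (I' := I)
    (J := I.tangent) (m := ∞) (n := ∞) (x₀ := p₀)
    (fun (p : TangentBundle I G) (h : G) => p.1⁻¹ * h) (fun p => p.1)
    ((((contMDiff_proj (TangentSpace I)).comp contMDiff_fst).inv.mul contMDiff_snd).contMDiffAt) (contMDiffAt_proj (TangentSpace I)) (by simp)
  have e : (fun p : TangentBundle I G => p.1⁻¹ * p.1) = fun p => 1 := by ext; simp
  rw [e] at hϕ
  have := ContMDiffAt.clm_apply_of_inCoordinates (b₂ := fun _ : TangentBundle I G => (1 : G)) (b₁ := fun p => p.1)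
    (ϕ := fun p => leftMulInv I p.1) (v := fun p => p.2) (IB₂ := I) hϕ contMDiffAt_id contMDiffAt_const
  rw [contMDiffAt_totalSpace] at this
  have h2 : ContMDiffAt I.tangent 𝓘(ℝ, E) ∞
      (fun x : TangentBundle I G => (show E from leftMulInv I x.1 x.2)) p₀ := by
    convert! this.2 using 1
    ext p
    exact (trivializationAt_self_snd 1 _).symm
  exact ContMDiffAt.prodMk (N' := E) (contMDiffAt_proj (TangentSpace I)) h2

theorem contMDiff_coMul : ContMDiff (I.prod 𝓘(ℝ, E →L[ℝ] ℝ)) (I.prod 𝓘(ℝ, E →L[ℝ] ℝ)) ∞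
    (fun p : G × (E →L[ℝ] ℝ) => (⟨p.1, ContinuousLinearMap.comp p.2 (leftMulInv I p.1)⟩ : CotangentBundle I G)) := by
  intro p₀
  have hϕ := ContMDiffAt.mfderiv (I := I) (I' := I)
    (J := I.prod 𝓘(ℝ, E →L[ℝ] ℝ)) (m := ∞) (n := ∞) (x₀ := p₀)
    (fun (p : G × (E →L[ℝ] ℝ)) (h : G) => p.1⁻¹ * h) (fun p => p.1)
    ((contMDiff_fst.fst.inv.mul contMDiff_snd).contMDiffAt) contMDiffAt_fst (by simp)
  have e : (fun p : G × (E →L[ℝ] ℝ) => p.1⁻¹ * p.1) = fun p => 1 := by ext; simp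
  rw [e] at hϕ
  rw [contMDiffAt_hom_bundle]
  refine ⟨contMDiffAt_fst, ?_⟩
  convert! ContMDiffAt.clm_comp (contMDiffAt_snd (n := ∞)) hϕ using 1
  ext p w
  simp only [inTangentCoordinates, ContinuousLinearMap.inCoordinates]
  simp only [ContinuousLinearMap.comp_apply]
  rw [Trivialization.continuousLinearMapAt_apply, Trivialization.continuousLinearMapAt_apply, Trivialization.coe_linearMapAt_of_mem, Trivialization.coe_linearMapAt_of_mem]
  · exact congrArg p.2 (trivializationAt_self_snd 1 _).symm
  · exact mem_baseSet_trivializationAt E (TangentSpace I) 1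
  · trivial

/-- The left trivialization `φ : G × 𝔤 × 𝔤* → TG ⊕ T*G`, `(g, ξ, μ) ↦ (g, g ξ, g μ)`, where
`⟨g μ, v⟩ = ⟨μ, g⁻¹ v⟩`. The Lie algebra `𝔤 = T_1 G` is written as the model space `E`, which
carries its manifold structure. -/
def leftTrivialization (x : G × E × (E →L[ℝ] ℝ)) : PontryaginBundle I G :=
  ⟨x.1, (leftMul I x.1 x.2.1, ContinuousLinearMap.comp x.2.2 (leftMulInv I x.1))⟩

variable (L : Lagrangian I G)

/-- `∂L/∂v (g, v)`, the derivative of `L` along the fibre `T_g G`. -/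
def fiberDerivative (x : TangentBundle I G) : TangentSpace I x.1 →L[ℝ] ℝ :=
  fderiv ℝ (fun w : E => L ⟨x.1, w⟩) x.2

/-- The Legendre transform `FL : TG → T*G`, `(g, v) ↦ (g, ∂L/∂v (g, v))`. -/
def legendreTransform (x : TangentBundle I G) : CotangentBundle I G :=
  ⟨x.1, fiberDerivative L x⟩

/-- The Legendre transform is invertible: it is a diffeomorphism from `TG` onto `T*G`. -/
def Hyperregular : Prop :=
  ∃ Φ : Diffeomorph I.tangent (I.prod 𝓘(ℝ, E →L[ℝ] ℝ)) (TangentBundle I G)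
    (CotangentBundle I G) ∞, ∀ x, Φ x = legendreTransform L x

/-- The left-trivialized Lagrangian `ℓ(g, ξ) = L(g, g ξ)`. -/
def leftLagrangian (g : G) (ξ : E) : ℝ := L ⟨g, leftMul I g ξ⟩

/-- `∂ℓ/∂ξ (g, ξ)`, an element of `𝔤*`. -/
def dLagrangian_dξ (g : G) (ξ : E) : E →L[ℝ] ℝ := fderiv ℝ (fun ζ : E => leftLagrangian L g ζ) ξ

/-- `∂ℓ/∂g (g, ξ)`, an element of `T*_g G`: the derivative of `h ↦ ℓ(h, ξ)` at `g`. -/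
def dLagrangian_dg (g : G) (ξ : E) : TangentSpace I g →L[ℝ] ℝ :=
  mfderiv I 𝓘(ℝ, ℝ) (fun h : G => leftLagrangian L h ξ) g

theorem contMDiff_leftLagrangian : ContMDiff (I.prod 𝓘(ℝ, E)) 𝓘(ℝ, ℝ) ∞
    (fun p : G × E => leftLagrangian L p.1 p.2) :=
  L.contMDiff.comp contMDiff_leftMul

theorem contMDiff_dLagrangian_dξ : ContMDiff (I.prod 𝓘(ℝ, E)) 𝓘(ℝ, E →L[ℝ] ℝ) ∞
    (fun p : G × E => dLagrangian_dξ L p.1 p.2) := by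
  intro p₀
  have h := ContMDiffAt.mfderiv (I := 𝓘(ℝ, E)) (I' := 𝓘(ℝ, ℝ)) (J := I.prod 𝓘(ℝ, E))
    (m := ∞) (n := ∞) (x₀ := p₀)
    (fun (p : G × E) (ξ : E) => leftLagrangian L p.1 ξ) (fun p => p.2)
    (((contMDiff_leftLagrangian L).comp (contMDiff_fst.fst.prodMk contMDiff_snd)).contMDiffAt)
    contMDiffAt_snd (by simp)
  have e := inTangentCoordinates_model_space (I := 𝓘(ℝ, E)) (I' := 𝓘(ℝ, ℝ))
    (fun p : G × E => p.2) (fun p => leftLagrangian L p.1 p.2)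
    (fun p => dLagrangian_dξ L p.1 p.2) p₀
  have e' : (fun p : G × E => dLagrangian_dξ L p.1 p.2) =
      fun p : G × E => mfderiv 𝓘(ℝ, E) 𝓘(ℝ, ℝ) (fun ξ : E => leftLagrangian L p.1 ξ) p.2 := by
    funext p
    exact (mfderiv_eq_fderiv (𝕜 := ℝ) (E := E) (E' := ℝ)
      (f := fun ξ : E => leftLagrangian L p.1 ξ) (x := p.2)).symm
  rw [← e, e']
  exact h

theorem fiberDerivative_eq (g : G) (ξ : E) :
    fiberDerivative L ⟨g, leftMul I g ξ⟩ =
      ContinuousLinearMap.comp (dLagrangian_dξ L g ξ) (leftMulInv I g) := by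
  let A : E ≃L[ℝ] E := ContinuousLinearEquiv.equivOfInverse (M₁ := E) (M₂ := E)
    (leftMul I g) (leftMulInv I g) (leftMulInv_leftMul g) (leftMul_leftMulInv g)
  have h := A.comp_right_fderiv (f := fun w : E => L ⟨g, w⟩) (x := ξ)
  have h' : dLagrangian_dξ L g ξ = (fiberDerivative L ⟨g, leftMul I g ξ⟩ : E →L[ℝ] ℝ).comp (A : E →L[ℝ] E) := h
  rw [h']
  refine ContinuousLinearMap.ext fun v => ?_
  exact congrArg (fiberDerivative L ⟨g, leftMul I g ξ⟩) (leftMul_leftMulInv g v).symm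

theorem contMDiff_leftTrivialization :
    ContMDiff (I.prod (𝓘(ℝ, E).prod 𝓘(ℝ, E →L[ℝ] ℝ))) (I.prod 𝓘(ℝ, E × (E →L[ℝ] ℝ))) ∞
      (leftTrivialization (I := I) (G := G)) := by
  intro p₀
  have h1 := (contMDiff_leftMul (I := I) (G := G)).comp
    (contMDiff_fst.prodMk contMDiff_snd.fst :
      ContMDiff (I.prod (𝓘(ℝ, E).prod 𝓘(ℝ, E →L[ℝ] ℝ))) _ ∞ (fun p : G × E × (E →L[ℝ] ℝ) => (p.1, p.2.1))) p₀
  have h2 := (contMDiff_coMul (I := I) (G := G)).comp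
    (contMDiff_fst.prodMk contMDiff_snd.snd :
      ContMDiff (I.prod (𝓘(ℝ, E).prod 𝓘(ℝ, E →L[ℝ] ℝ))) _ ∞ (fun p : G × E × (E →L[ℝ] ℝ) => (p.1, p.2.2))) p₀
  rw [contMDiffAt_totalSpace] at h1 h2 ⊢
  exact ⟨h1.1, h1.2.prodMk_space h2.2⟩

/-- The natural projection `TG ⊕ T*G → T*G`, `(g, v, p) ↦ (g, p)`. -/
def piHP (x : PontryaginBundle I G) : CotangentBundle I G := ⟨x.1, x.2.2⟩

/-- The projection `TG ⊕ T*G → TG`, `(g, v, p) ↦ (g, v)`. -/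
def piT (x : PontryaginBundle I G) : TangentBundle I G := ⟨x.1, x.2.1⟩

theorem contMDiff_piHP : ContMDiff (I.prod 𝓘(ℝ, E × (E →L[ℝ] ℝ))) (I.prod 𝓘(ℝ, E →L[ℝ] ℝ)) ∞
    (piHP (I := I) (G := G)) := by
  intro p₀
  have h := contMDiffAt_id (I := I.prod 𝓘(ℝ, E × (E →L[ℝ] ℝ))) (n := ∞) (x := p₀)
  rw [contMDiffAt_totalSpace] at h ⊢
  have h' := ContMDiffAt.comp p₀
    (g := (Prod.snd : E × (E →L[ℝ] ℝ) → E →L[ℝ] ℝ)) contDiff_snd.contMDiff.contMDiffAt h.2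
  exact ⟨h.1, h'⟩

theorem contMDiff_piT : ContMDiff (I.prod 𝓘(ℝ, E × (E →L[ℝ] ℝ))) I.tangent ∞
    (piT (I := I) (G := G)) := by
  intro p₀
  have h := contMDiffAt_id (I := I.prod 𝓘(ℝ, E × (E →L[ℝ] ℝ))) (n := ∞) (x := p₀)
  rw [contMDiffAt_totalSpace] at h ⊢
  have h' := ContMDiffAt.comp p₀
    (g := (Prod.fst : E × (E →L[ℝ] ℝ) → E)) contDiff_fst.contMDiff.contMDiffAt h.2
  exact ⟨h.1, h'⟩

/-- The admissible space `{(g, v, p) ∈ TG ⊕ T*G | p = ∂L/∂v (g, v)}`. -/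
def admissibleHP : Set (PontryaginBundle I G) :=
  {x | x.2.2 = fiberDerivative L ⟨x.1, x.2.1⟩}

/-- The left-trivialized admissible space `{(g, ξ, μ) ∈ G × 𝔤 × 𝔤* | μ = ∂ℓ/∂ξ (g, ξ)}`. -/
def admissibleLeft : Set (G × E × (E →L[ℝ] ℝ)) :=
  {x | x.2.2 = dLagrangian_dξ L x.1 x.2.1}

/-- The left-trivialized admissible space is the graph of the smooth map `∂ℓ/∂ξ` over `G × 𝔤`; its
manifold structure is the one of this graph. -/
def admissibleLeftHomeo : admissibleLeft L ≃ₜ G × E where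
  toFun x := (x.1.1, x.1.2.1)
  invFun p := ⟨(p.1, p.2, dLagrangian_dξ L p.1 p.2), rfl⟩
  left_inv := by
    rintro ⟨⟨g, ξ, μ⟩, h⟩
    have h' : μ = dLagrangian_dξ L g ξ := h
    subst h'
    rfl
  right_inv _ := rfl
  continuous_toFun := by fun_prop
  continuous_invFun := Continuous.subtype_mk (continuous_fst.prodMk
    (continuous_snd.prodMk (contMDiff_dLagrangian_dξ L).continuous)) _

instance : ChartedSpace (ModelProd H E) (admissibleLeft L) :=
  transportedCharts (admissibleLeftHomeo L)

instance : IsManifold (I.prod 𝓘(ℝ, E)) ∞ (admissibleLeft L) :=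
  transportedCharts_isManifold (admissibleLeftHomeo L)

/-- `(g, v) ↦ (g, v, ∂L/∂v (g, v))`. -/
def legendreGraph (x : TangentBundle I G) : PontryaginBundle I G := ⟨x.1, (x.2, fiberDerivative L x)⟩

theorem contMDiff_legendreGraph :
    ContMDiff I.tangent (I.prod 𝓘(ℝ, E × (E →L[ℝ] ℝ))) ∞ (legendreGraph L) := by
  have h := contMDiff_leftTrivialization.comp ((contMDiff_fst.prodMk
    (contMDiff_snd.prodMk (contMDiff_dLagrangian_dξ L))).comp
      (contMDiff_leftMulInv (I := I) (G := G)))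
  convert! h using 1
  funext x
  obtain ⟨g, v⟩ := x
  have h1 := fiberDerivative_eq L g (leftMulInv I g v)
  rw [leftMul_leftMulInv] at h1
  simp only [legendreGraph, leftTrivialization, Function.comp]
  rw [h1, leftMul_leftMulInv]

/-- The admissible space in `TG ⊕ T*G` is a smooth graph over `TG`; its manifold structure is the one
of this graph. -/
def admissibleHPHomeo : admissibleHP L ≃ₜ TangentBundle I G where
  toFun x := piT x.1
  invFun x := ⟨legendreGraph L x, rfl⟩
  left_inv := by
    rintro ⟨⟨g, v, p⟩, h⟩
    have h' : p = fiberDerivative L ⟨g, v⟩ := h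
    subst h'
    rfl
  right_inv _ := rfl
  continuous_toFun := contMDiff_piT.continuous.comp continuous_subtype_val
  continuous_invFun := Continuous.subtype_mk (contMDiff_legendreGraph L).continuous _

instance : ChartedSpace (ModelProd H E) (admissibleHP L) :=
  transportedCharts (admissibleHPHomeo L)

instance : IsManifold I.tangent ∞ (admissibleHP L) :=
  transportedCharts_isManifold (admissibleHPHomeo L)

theorem contMDiff_admissibleLeft_val :
    ContMDiff (I.prod 𝓘(ℝ, E)) (I.prod (𝓘(ℝ, E).prod 𝓘(ℝ, E →L[ℝ] ℝ))) ∞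
      (Subtype.val : admissibleLeft L → G × E × (E →L[ℝ] ℝ)) := by
  have h := (contMDiff_fst.prodMk (contMDiff_snd.prodMk (contMDiff_dLagrangian_dξ L))).comp
      (contMDiff_transported (admissibleLeftHomeo L))
  convert! h using 1
  funext x
  exact congrArg Subtype.val ((admissibleLeftHomeo L).symm_apply_apply x).symm

theorem contMDiff_admissibleHP_val :
    ContMDiff I.tangent (I.prod 𝓘(ℝ, E × (E →L[ℝ] ℝ))) ∞
      (Subtype.val : admissibleHP L → PontryaginBundle I G) := by
  have h := (contMDiff_legendreGraph L).comp (contMDiff_transported (admissibleHPHomeo L))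
  convert! h using 1
  funext x
  exact congrArg Subtype.val ((admissibleHPHomeo L).symm_apply_apply x).symm

/-- The left trivialization restricted to the admissible spaces. -/
def leftTrivializationRestr (x : admissibleLeft L) : admissibleHP L :=
  ⟨leftTrivialization x.1, by
    obtain ⟨⟨g, ξ, μ⟩, h⟩ := x
    have h' : μ = dLagrangian_dξ L g ξ := h
    subst h'
    exact (fiberDerivative_eq L g ξ).symm⟩

theorem contMDiff_leftTrivializationRestr :
    ContMDiff (I.prod 𝓘(ℝ, E)) I.tangent ∞ (leftTrivializationRestr L) := by
  have h := (contMDiff_transported_symm (I := I.tangent) (admissibleHPHomeo L)).comp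
    (contMDiff_piT.comp
      (contMDiff_leftTrivialization.comp (contMDiff_admissibleLeft_val L)))
  convert! h using 1
  funext x
  exact ((admissibleHPHomeo L).symm_apply_apply (leftTrivializationRestr L x)).symm

/-- The natural projection restricted to the admissible space. -/
def piHPRestr (x : admissibleHP L) : CotangentBundle I G := piHP x.1

variable (I G) in
/-- The canonical one-form `Θ` on `T*G`: `Θ_(g,p) (w) = ⟨p, dπ w⟩` for the projection `π : T*G → G`. -/
def canonicalOneForm : DiffForm (I.prod 𝓘(ℝ, E →L[ℝ] ℝ)) (CotangentBundle I G) 1 := fun x =>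
  ContinuousAlternatingMap.ofSubsingleton ℝ _ ℝ (0 : Fin 1)
    (ContinuousLinearMap.comp x.2 (mfderiv (I.prod 𝓘(ℝ, E →L[ℝ] ℝ)) I
      (TotalSpace.proj : CotangentBundle I G → G) x))

variable (I G) in
/-- The canonical symplectic form `Ω = dΘ` on `T*G`. -/
def canonicalTwoForm : DiffForm (I.prod 𝓘(ℝ, E →L[ℝ] ℝ)) (CotangentBundle I G) 2 :=
  exteriorDerivative (I.prod 𝓘(ℝ, E →L[ℝ] ℝ)) (canonicalOneForm I G)

/-- The symplectic form on the admissible space in `TG ⊕ T*G`: the pullback of `Ω` by the restricted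
projection. -/
def symplecticFormHP : DiffForm I.tangent (admissibleHP L) 2 :=
  formPullback I.tangent (I.prod 𝓘(ℝ, E →L[ℝ] ℝ)) (piHPRestr L) (canonicalTwoForm I G)

/-- The symplectic form on the left-trivialized admissible space: the pullback of the previous form
by the restricted left trivialization. -/
def symplecticFormLeft : DiffForm (I.prod 𝓘(ℝ, E)) (admissibleLeft L) 2 :=
  formPullback (I.prod 𝓘(ℝ, E)) I.tangent (leftTrivializationRestr L) (symplecticFormHP L)

section Flow
variable [FiniteDimensional ℝ E]

/-- The map `ad*_ξ` on `𝔤*`: `⟨ad*_ξ μ, η⟩ = ⟨μ, [ξ, η]⟩`. -/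
def coad (ξ : GroupLieAlgebra I G) (μ : GroupLieAlgebra I G →L[ℝ] ℝ) :
    GroupLieAlgebra I G →L[ℝ] ℝ :=
  haveI : CompleteSpace E := FiniteDimensional.complete ℝ E
  haveI : LieGroup I (minSmoothness ℝ 3) G := by
    rw [minSmoothness_of_isRCLikeNormedField]; infer_instance
  let adξ : E →ₗ[ℝ] E := LieAlgebra.ad ℝ (GroupLieAlgebra I G) ξ
  let ν : E →L[ℝ] ℝ := μ
  ν.comp (LinearMap.toContinuousLinearMap (𝕜 := ℝ) (E := E) (F' := E) adξ)

theorem coad_apply (ξ η : GroupLieAlgebra I G) (μ : GroupLieAlgebra I G →L[ℝ] ℝ) :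
    coad ξ μ η = μ ⁅ξ, η⁆ := rfl

/-- Solutions on `[a, b]` of the left-trivialized HP equations
`ġ = g ξ`, `μ̇ = ad*_ξ μ + g ∂ℓ/∂g (g, ξ)`, `μ = ∂ℓ/∂ξ (g, ξ)`.
The covector `g ∂ℓ/∂g ∈ 𝔤*` is `η ↦ ⟨∂ℓ/∂g, g η⟩`. -/
structure IsHPSolution (a b : ℝ) (g : ℝ → G) (ξ : ℝ → E) (μ : ℝ → E →L[ℝ] ℝ) : Prop where
  reconstruction : ∀ t ∈ Icc a b, HasMFDerivWithinAt 𝓘(ℝ, ℝ) I g (Icc a b) t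
    (ContinuousLinearMap.smulRight (1 : ℝ →L[ℝ] ℝ) (leftMul I (g t) (ξ t)))
  momentum : ∀ t ∈ Icc a b, HasDerivWithinAt μ
    (coad (I := I) (G := G) (ξ t) (μ t) + (dLagrangian_dg L (g t) (ξ t)).comp (leftMul I (g t)))
    (Icc a b) t
  legendre : ∀ t ∈ Icc a b, μ t = dLagrangian_dξ L (g t) (ξ t)

/-- Some solution on `[a, b]` starts at `x` at time `a` and ends at `y` at time `b`. -/
def HPConnects (a b : ℝ) (x y : admissibleLeft L) : Prop :=
  ∃ (g : ℝ → G) (ξ : ℝ → E) (μ : ℝ → E →L[ℝ] ℝ), IsHPSolution L a b g ξ μ ∧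
    (g a, ξ a, μ a) = x.1 ∧ (g b, ξ b, μ b) = y.1

/-- The initial conditions for which the equations have a solution on all of `[a, b]`. -/
def flowDomain (a b : ℝ) : Set (admissibleLeft L) := {x | ∃ y, HPConnects L a b x y}

open Classical in
/-- The left-trivialized HP flow map from time `a` to time `b`: an initial condition is sent to the
end point of the solution that starts there. Off `flowDomain` the value is irrelevant. -/
def flowMap (a b : ℝ) (x : admissibleLeft L) : admissibleLeft L :=
  if h : ∃ y, HPConnects L a b x y then h.choose else x
end Flow

end
end
end HPFlow

open HPFlow

namespace HPFlow

set_option synthInstance.maxHeartbeats 200000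

/-! ### Local flows in a Banach space and their derivative in the initial condition. -/

section LocalFlow
open Metric
variable {F : Type*} [NormedAddCommGroup F] [NormedSpace ℝ F]

/-! Hyperregularity removes the velocity. Inverting the Legendre transform and left trivializing
gives a smooth ξ = X(g, μ) (`Hyperregular.exists_isVelocity`). So (g, ξ, μ) ↦ (g, μ) identifies the
admissible space with G × 𝔤*, and the HP equations become the integral curve equation of the
autonomous field `hpField` there (`IsVelocity.hpConnects_iff`). The form on the admissible space is
the pullback of `momentumTwoForm`, the form Ω read through (g, μ) ↦ (g, gμ). Hence it suffices to
show that the flow of `hpField` preserves `momentumTwoForm`.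

In a chart of G let A(q) be the left-invariant frame and B(q) = A(q)⁻¹ the coframe. Then Θ becomes θ
= μ(B(q) dq) and `momentumTwoForm` becomes dθ (`momentumTwoForm_apply`). The structure equation
expresses the Lie bracket through derivatives of A (`groupFrame_bracket`). Together with the
equation for μ̇ and the Legendre condition, it gives that the Lie derivative of θ along the field is
the exact form dℓ, where ℓ is evaluated at ξ = X (`lieDeriv_coframeOneForm`). This is the
infinitesimal form of Hamilton's principle. Taking d, the Lie derivative of dθ vanishes
(`lieDerivAltZeroAt_fderiv`).

To pass from infinitesimal to finite invariance, the local flow is built together with the solution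
V of its linearized equation, and V is shown to be the derivative of the flow (`exists_local_flow`).
Then dθ(Vu, Vu') has zero time derivative along each short trajectory. A trajectory on [0, s] has
compact image, so one step size works at all of its points, and finitely many short flows are
composed (`FlowRel.flowPreservesAt`). The predicate `FlowPreservesAt` carries existence of the flow
nearby, differentiability and invariance at once, so openness of the domain and differentiability of
the flow map come out of the same induction. Well-definedness is uniqueness of integral curves,
which uses that G is Hausdorff. -/

theorem hasDerivWithinAt_Ici_of_Icc {f : ℝ → F} {f' : F} {a b t : ℝ}
    (h : HasDerivWithinAt f f' (Icc a b) t) (ht : t ∈ Ico a b) :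
    HasDerivWithinAt f f' (Ici t) t :=
  h.mono_of_mem_nhdsWithin (Icc_mem_nhdsGE_of_mem ht)

/-- Second order Taylor estimate for a map with Lipschitz derivative on a convex set. -/
theorem norm_sub_sub_fderiv_le {f : F → F} {S : Set F} (hS : Convex ℝ S) {K : ℝ} (hK : 0 ≤ K)
    (hd : ∀ y ∈ S, DifferentiableAt ℝ f y)
    (hlip : ∀ y ∈ S, ∀ z ∈ S, ‖fderiv ℝ f z - fderiv ℝ f y‖ ≤ K * ‖z - y‖)
    {y z : F} (hy : y ∈ S) (hz : z ∈ S) :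
    ‖f z - f y - fderiv ℝ f y (z - y)‖ ≤ K * ‖z - y‖ ^ 2 := by
  have h := (convex_segment (𝕜 := ℝ) y z).norm_image_sub_le_of_norm_hasFDerivWithin_le'
    (f := f) (f' := fderiv ℝ f) (φ := fderiv ℝ f y) (C := K * ‖z - y‖)
    (fun w hw => (hd w (hS.segment_subset hy hz hw)).hasFDerivAt.hasFDerivWithinAt)
    (fun w hw => (hlip y hy w (hS.segment_subset hy hz hw)).trans
      (mul_le_mul_of_nonneg_left (by
        simpa [norm_sub_rev] using norm_sub_le_of_mem_segment hw) hK))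
    (left_mem_segment ℝ y z) (right_mem_segment ℝ y z)
  calc _ ≤ K * ‖z - y‖ * ‖z - y‖ := h
    _ = _ := by ring

/-- With zero initial error the Grönwall bound is linear in the forcing term. This lets the factor
‖z - y‖² be pulled out of the error estimate for the flow. -/
theorem gronwallBound_zero_mul (K c ε x : ℝ) :
    gronwallBound 0 K (c * ε) x = c * gronwallBound 0 K ε x := by
  by_cases hK : K = 0
  · simp [gronwallBound, hK, mul_assoc]
  · simp only [gronwallBound, hK, if_false]; ring

/-- A solution of the linearized equation is the derivative of the flow. -/
theorem hasFDerivAt_flow {f : F → F} {S U : Set F} (hS : Convex ℝ S) {K M C ε : ℝ} (hK : 0 ≤ K)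
    (hd : ∀ y ∈ S, DifferentiableAt ℝ f y)
    (hlip : ∀ y ∈ S, ∀ z ∈ S, ‖fderiv ℝ f z - fderiv ℝ f y‖ ≤ K * ‖z - y‖)
    (hM : ∀ y ∈ S, ‖fderiv ℝ f y‖ ≤ M)
    {α : F → ℝ → F} {y : F} {V : ℝ → F →L[ℝ] F} (hU : U ∈ nhds y)
    (h0 : ∀ z ∈ U, α z 0 = z) (hV0 : V 0 = ContinuousLinearMap.id ℝ F)
    (hmem : ∀ z ∈ U, ∀ t ∈ Icc 0 ε, α z t ∈ S)
    (hα : ∀ z ∈ U, ∀ t ∈ Icc 0 ε, HasDerivWithinAt (α z) (f (α z t)) (Icc 0 ε) t)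
    (hC : ∀ z ∈ U, ∀ t ∈ Icc 0 ε, ‖α z t - α y t‖ ≤ C * ‖z - y‖)
    (hV : ∀ t ∈ Icc 0 ε, HasDerivWithinAt V ((fderiv ℝ f (α y t)).comp (V t)) (Icc 0 ε) t) :
    ∀ t ∈ Icc 0 ε, HasFDerivAt (fun z => α z t) (V t) y := by
  intro t ht
  have hyU := mem_of_mem_nhds hU
  have key : ∀ z ∈ U, ‖α z t - α y t - V t (z - y)‖ ≤
      ‖z - y‖ ^ 2 * gronwallBound 0 M (K * C ^ 2) t := by
    intro z hz
    have hr : ∀ s ∈ Icc 0 ε, HasDerivWithinAt (fun s => α z s - α y s - V s (z - y))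
        (f (α z s) - f (α y s) - fderiv ℝ f (α y s) (V s (z - y))) (Icc 0 ε) s := by
      intro s hs
      exact ((hα z hz s hs).sub (hα y hyU s hs)).sub
        (((hV s hs).clm_apply (hasDerivWithinAt_const s _ (z - y))).congr_deriv (by simp))
    have hb := norm_le_gronwallBound_of_norm_deriv_right_le (δ := 0) (K := M)
      (ε := ‖z - y‖ ^ 2 * (K * C ^ 2))
      (fun s hs => (hr s hs).continuousWithinAt)
      (fun s hs => hasDerivWithinAt_Ici_of_Icc (hr s (Ico_subset_Icc_self hs)) hs)
      (by simp [h0 z hz, h0 y hyU, hV0])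
      (fun s hs => by
        have hs' := Ico_subset_Icc_self hs
        -- The error α z - α y - V (z - y) solves the linearized equation up to a Taylor remainder.
        -- By Lipschitz dependence on the initial value, that remainder is at most K (C ‖z - y‖)².
        have e : f (α z s) - f (α y s) - fderiv ℝ f (α y s) (V s (z - y)) =
            fderiv ℝ f (α y s) (α z s - α y s - V s (z - y)) +
            (f (α z s) - f (α y s) - fderiv ℝ f (α y s) (α z s - α y s)) := by
          simp only [map_sub]; abel
        rw [e]
        refine (norm_add_le _ _).trans (add_le_add ?_ ?_)
        · exact (ContinuousLinearMap.le_opNorm _ _).trans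
            (mul_le_mul_of_nonneg_right (hM _ (hmem y hyU s hs')) (norm_nonneg _))
        · refine (norm_sub_sub_fderiv_le hS hK hd hlip (hmem y hyU s hs')
            (hmem z hz s hs')).trans ?_
          calc K * ‖α z s - α y s‖ ^ 2 ≤ K * (C * ‖z - y‖) ^ 2 := by
                gcongr; exact hC z hz s hs'
            _ = _ := by ring)
      t ht
    rwa [gronwallBound_zero_mul, sub_zero] at hb
  have hO : (fun z => α z t - V t z - (α y t - V t y)) =O[nhds y] fun z => ‖z - y‖ ^ 2 := by
    refine Asymptotics.IsBigO.of_bound (gronwallBound 0 M (K * C ^ 2) t) ?_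
    filter_upwards [hU] with z hz
    have := key z hz
    rw [map_sub] at this
    rw [show α z t - V t z - (α y t - V t y) = α z t - α y t - (V t z - V t y) by abel]
    simpa [mul_comm] using this
  have h1 : HasFDerivAt (fun z => α z t - V t z) (0 : F →L[ℝ] F) y := by
    rw [hasFDerivAt_iff_isLittleO]
    simp only [_root_.zero_apply, sub_zero]
    refine hO.trans_isLittleO ?_
    have := Asymptotics.isLittleO_pow_sub_sub y (m := 2) (by norm_num)
    simpa using this
  have h2 := h1.add (V t).hasFDerivAt
  rw [zero_add] at h2
  exact h2.congr_of_eventuallyEq (.of_forall fun z => by simp)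

variable [CompleteSpace F]

/-- Local flow of a `C²` vector field together with the solution of the linearized equation, which
is the derivative of the flow in the initial condition. -/
theorem exists_local_flow {f : F → F} {y₀ : F} (hf : ContDiffAt ℝ 2 f y₀) {W : Set F}
    (hW : W ∈ nhds y₀) :
    ∃ ε > 0, ∃ U ∈ nhds y₀, ∃ (α : F → ℝ → F) (V : F → ℝ → F →L[ℝ] F), ∀ y ∈ U,
      α y 0 = y ∧ V y 0 = ContinuousLinearMap.id ℝ F ∧ ∀ t ∈ Icc 0 ε, α y t ∈ W ∧
        HasDerivWithinAt (α y) (f (α y t)) (Icc 0 ε) t ∧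
        HasDerivWithinAt (V y) ((fderiv ℝ f (α y t)).comp (V y t)) (Icc 0 ε) t ∧
        HasFDerivAt (fun z => α z t) (V y t) y := by
  have hf' : ContDiffAt ℝ 1 (fderiv ℝ f) y₀ := hf.fderiv_right (by norm_num)
  obtain ⟨K, s, hs, hl⟩ := hf'.exists_lipschitzOnWith
  have hdiff : ∀ᶠ y in nhds y₀, DifferentiableAt ℝ f y :=
    (hf.eventually (by simp)).mono fun y hy => hy.differentiableAt (by norm_num)
  have hbd : ∀ᶠ y in nhds y₀, ‖fderiv ℝ f y‖ ≤ ‖fderiv ℝ f y₀‖ + 1 :=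
    (hf'.continuousAt.norm.eventually_lt continuousAt_const (by simp)).mono fun y hy => hy.le
  obtain ⟨R, hR, hRsub⟩ := Metric.mem_nhds_iff.1
    (Filter.inter_mem (Filter.inter_mem hs hW) (Filter.inter_mem hdiff hbd))
  -- The equation is coupled to its linearization, so that one application of Picard–Lindelöf yields
  -- both the flow and the candidate V for its derivative. The coupled field is C¹ because f is C².
  let g : F × (F →L[ℝ] F) → F × (F →L[ℝ] F) := fun p => (f p.1, (fderiv ℝ f p.1).comp p.2)
  let p₀ : F × (F →L[ℝ] F) := (y₀, ContinuousLinearMap.id ℝ F)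
  have hg : ContDiffAt ℝ 1 g p₀ := by
    have h1 : ContDiffAt ℝ 1 (fun p : F × (F →L[ℝ] F) => f p.1) p₀ :=
      ContDiffAt.comp p₀ (hf.of_le (by norm_num)) contDiffAt_fst
    have h2 : ContDiffAt ℝ 1 (fun p : F × (F →L[ℝ] F) => fderiv ℝ f p.1) p₀ :=
      ContDiffAt.comp p₀ hf' contDiffAt_fst
    exact h1.prodMk (h2.clm_comp contDiffAt_snd)
  obtain ⟨ε, hε, a, r, L, K', hr, hpl⟩ := IsPicardLindelof.of_contDiffAt_one hg
  obtain ⟨β, hβ, C, hC⟩ :=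
    (hpl 0).exists_forall_mem_closedBall_eq_hasDerivWithinAt_lipschitzOnWith
  have hcont : ContinuousOn (Function.uncurry β) (closedBall p₀ r ×ˢ Icc (0 - ε) (0 + ε)) :=
    continuousOn_prod_of_continuousOn_lipschitzOnWith _ C
      (fun x hx => HasDerivWithinAt.continuousOn (hβ x hx).2) hC
  have hnhd : closedBall p₀ r ×ˢ Icc (0 - ε) (0 + ε) ∈ nhds (p₀, (0 : ℝ)) :=
    prod_mem_nhds (closedBall_mem_nhds _ hr) (Icc_mem_nhds (by linarith) (by linarith))
  have hev : ∀ᶠ q in nhds p₀ ×ˢ nhds (0 : ℝ), (β q.1 q.2).1 ∈ ball y₀ R := by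
    rw [← nhds_prod_eq]
    have hc := (hcont.continuousAt hnhd).fst
    refine hc (isOpen_ball.mem_nhds ?_)
    have : β p₀ 0 = p₀ := (hβ p₀ (mem_closedBall_self r.2)).1
    simp [Function.uncurry, this, p₀, hR]
  obtain ⟨P, hP, Q, hQ, hPQ⟩ := Filter.eventually_prod_iff.1 hev
  obtain ⟨δ, hδ, hδQ⟩ := Metric.mem_nhds_iff.1 hQ
  -- The time is shortened so that all trajectories starting in `U` stay in the ball of radius `R`,
  -- where the bounds on f and its derivative hold.
  let ε' := min ε (δ / 2)
  have hε' : 0 < ε' := lt_min hε (by positivity)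
  have hsub : Icc 0 ε' ⊆ Icc (0 - ε) (0 + ε) := fun t ht =>
    ⟨by linarith [ht.1], by linarith [ht.2, min_le_left ε (δ / 2)]⟩
  have hQ' : ∀ t ∈ Icc 0 ε', Q t := fun t ht => hδQ (by
    rw [mem_ball, Real.dist_eq, sub_zero, abs_of_nonneg ht.1]
    linarith [ht.2, min_le_right ε (δ / 2)])
  let i : F → F × (F →L[ℝ] F) := fun y => (y, ContinuousLinearMap.id ℝ F)
  have hi : Continuous i := by fun_prop
  have hU : {y | P (i y) ∧ i y ∈ closedBall p₀ r} ∈ nhds y₀ :=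
    hi.continuousAt (x := y₀) (Filter.inter_mem hP (closedBall_mem_nhds p₀ hr))
  obtain ⟨U, hUsub, hUo, hU₀⟩ := _root_.mem_nhds_iff.1 hU
  have hball : ∀ y ∈ U, ∀ t ∈ Icc 0 ε', (β (i y) t).1 ∈ ball y₀ R := fun y hy t ht =>
    hPQ (hUsub hy).1 (hQ' t ht)
  have hβ' : ∀ y ∈ U, ∀ t ∈ Icc 0 ε', HasDerivWithinAt (β (i y)) (g (β (i y) t)) (Icc 0 ε') t :=
    fun y hy t ht => ((hβ (i y) (hUsub hy).2).2 t (hsub ht)).mono hsub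
  refine ⟨ε', hε', U, hUo.mem_nhds hU₀, fun y t => (β (i y) t).1, fun y t => (β (i y) t).2,
    fun y hy => ?_⟩
  have h0 : ∀ z ∈ U, β (i z) 0 = i z := fun z hz => (hβ (i z) (hUsub hz).2).1
  have hfd := hasFDerivAt_flow (f := f) (S := ball y₀ R) (U := U) (convex_ball _ _) (K := K)
    (M := ‖fderiv ℝ f y₀‖ + 1) (C := C) (ε := ε') K.2 (fun z hz => (hRsub hz).2.1)
    (fun z hz w hw => by
      simpa [dist_eq_norm] using hl.dist_le_mul w (hRsub hw).1.1 z (hRsub hz).1.1)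
    (fun z hz => (hRsub hz).2.2) (α := fun y t => (β (i y) t).1) (y := y)
    (V := fun t => (β (i y) t).2) (hUo.mem_nhds hy)
    (fun z hz => by rw [h0 z hz]) (by rw [h0 y hy]) hball
    (fun z hz t ht => (hβ' z hz t ht).fst)
    (fun z hz t ht => by
      have h := (hC t (hsub ht)).dist_le_mul (i z) (hUsub hz).2 (i y) (hUsub hy).2
      rw [dist_eq_norm, dist_eq_norm] at h
      -- All initial values share the second component `id`, so the Lipschitz constant of the
      -- coupled flow also serves the flow of f.
      have e : ‖i z - i y‖ = ‖z - y‖ := by simp [i, Prod.norm_def]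
      rw [e] at h
      exact (norm_fst_le (β (i z) t - β (i y) t)).trans h)
    (fun t ht => (hβ' y hy t ht).snd)
  exact ⟨congrArg Prod.fst (h0 y hy), congrArg Prod.snd (h0 y hy), fun t ht =>
    ⟨(hRsub (hball y hy t ht)).1.2,
    (hβ' y hy t ht).fst, (hβ' y hy t ht).snd, hfd t ht⟩⟩

end LocalFlow

/-! ### Vanishing Lie derivative and constancy along the flow, in a vector space. -/

section Invariance
variable {F : Type*} [NormedAddCommGroup F] [NormedSpace ℝ F]

/-- Vanishing at `y` of the Lie derivative along `X` of the alternating part of the field of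
bilinear forms `g`. -/
def LieDerivAltZeroAt (X : F → F) (g : F → F →L[ℝ] F →L[ℝ] ℝ) (y : F) : Prop :=
  ∀ u u' : F, fderiv ℝ g y (X y) u u' + g y (fderiv ℝ X y u) u' + g y u (fderiv ℝ X y u') =
    fderiv ℝ g y (X y) u' u + g y (fderiv ℝ X y u') u + g y u' (fderiv ℝ X y u)

theorem hasDerivWithinAt_bilin_along_flow {X : F → F} {g : F → F →L[ℝ] F →L[ℝ] ℝ} {s : Set ℝ}
    {c : ℝ → F} {V : ℝ → F →L[ℝ] F} {t : ℝ} (hg : DifferentiableAt ℝ g (c t))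
    (hc : HasDerivWithinAt c (X (c t)) s t)
    (hV : HasDerivWithinAt V ((fderiv ℝ X (c t)).comp (V t)) s t) (u u' : F) :
    HasDerivWithinAt (fun t => g (c t) (V t u) (V t u'))
      (fderiv ℝ g (c t) (X (c t)) (V t u) (V t u') + g (c t) (fderiv ℝ X (c t) (V t u)) (V t u') +
        g (c t) (V t u) (fderiv ℝ X (c t) (V t u'))) s t := by
  have h1 : HasDerivWithinAt (fun t => g (c t)) (fderiv ℝ g (c t) (X (c t))) s t :=
    HasFDerivAt.comp_hasDerivWithinAt (E := F →L[ℝ] F →L[ℝ] ℝ) (F := F) t hg.hasFDerivAt hc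
  have h2 := hV.clm_apply (hasDerivWithinAt_const t _ u)
  have h3 := hV.clm_apply (hasDerivWithinAt_const t _ u')
  refine ((h1.clm_apply h2).clm_apply h3).congr_deriv ?_
  simp only [ContinuousLinearMap.comp_apply, map_zero, add_zero, _root_.add_apply]

/-- Since V solves the linearized equation, the product rule gives as time derivative the Lie
derivative of the alternating part of g, evaluated at V u and V u'. This is zero by hypothesis. -/
theorem alternating_const_along_flow {X : F → F} {g : F → F →L[ℝ] F →L[ℝ] ℝ} {W : Set F} {ε : ℝ}
    {c : ℝ → F} {V : ℝ → F →L[ℝ] F}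
    (hg : ∀ y ∈ W, DifferentiableAt ℝ g y) (hL : ∀ y ∈ W, LieDerivAltZeroAt X g y)
    (hcW : ∀ t ∈ Icc 0 ε, c t ∈ W)
    (hc : ∀ t ∈ Icc 0 ε, HasDerivWithinAt c (X (c t)) (Icc 0 ε) t)
    (hV : ∀ t ∈ Icc 0 ε, HasDerivWithinAt V ((fderiv ℝ X (c t)).comp (V t)) (Icc 0 ε) t)
    (u u' : F) : ∀ t ∈ Icc 0 ε,
      g (c t) (V t u) (V t u') - g (c t) (V t u') (V t u) =
        g (c 0) (V 0 u) (V 0 u') - g (c 0) (V 0 u') (V 0 u) := by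
  have hd : ∀ t ∈ Icc 0 ε, HasDerivWithinAt
      (fun t => g (c t) (V t u) (V t u') - g (c t) (V t u') (V t u)) 0 (Icc 0 ε) t := by
    intro t ht
    refine ((hasDerivWithinAt_bilin_along_flow (hg _ (hcW t ht)) (hc t ht) (hV t ht) u u').sub
      (hasDerivWithinAt_bilin_along_flow (hg _ (hcW t ht)) (hc t ht) (hV t ht) u' u)).congr_deriv ?_
    rw [hL _ (hcW t ht) (V t u) (V t u'), sub_self]
  intro t ht
  exact constant_of_has_deriv_right_zero (fun s hs => (hd s hs).continuousWithinAt)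
    (fun s hs => hasDerivWithinAt_Ici_of_Icc (hd s (Ico_subset_Icc_self hs)) hs) t ht

/-- If the Lie derivative of `θ` along `X` is exact, then that of `dθ` vanishes. -/
theorem lieDerivAltZeroAt_fderiv {X : F → F} {θ : F → F →L[ℝ] ℝ} {l : F → ℝ} {y : F}
    (hX : ContDiffAt ℝ 2 X y) (hθ : ContDiffAt ℝ 2 θ y) (hl : ContDiffAt ℝ 2 l y)
    (h : ∀ᶠ z in nhds y, ∀ u, fderiv ℝ θ z (X z) u + θ z (fderiv ℝ X z u) = fderiv ℝ l z u) :
    LieDerivAltZeroAt X (fderiv ℝ θ) y := by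
  have hX1 : DifferentiableAt ℝ (fderiv ℝ X) y :=
    (hX.fderiv_right (m := 1) (by norm_num)).differentiableAt (by norm_num)
  have hθ1 : DifferentiableAt ℝ (fderiv ℝ θ) y :=
    (hθ.fderiv_right (m := 1) (by norm_num)).differentiableAt (by norm_num)
  have hl1 : DifferentiableAt ℝ (fderiv ℝ l) y :=
    (hl.fderiv_right (m := 1) (by norm_num)).differentiableAt (by norm_num)
  have hX0 := (hX.differentiableAt (by norm_num)).hasFDerivAt
  have hθ0 := (hθ.differentiableAt (by norm_num)).hasFDerivAt
  have symX : ∀ u u', fderiv ℝ (fderiv ℝ X) y u u' = fderiv ℝ (fderiv ℝ X) y u' u :=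
    fun u u' => (hX.isSymmSndFDerivAt (by simp)) u u'
  have symθ : ∀ u u', fderiv ℝ (fderiv ℝ θ) y u u' = fderiv ℝ (fderiv ℝ θ) y u' u :=
    fun u u' => (hθ.isSymmSndFDerivAt (by simp)) u u'
  have syml : ∀ u u', fderiv ℝ (fderiv ℝ l) y u u' = fderiv ℝ (fderiv ℝ l) y u' u :=
    fun u u' => (hl.isSymmSndFDerivAt (by simp)) u u'
  -- This differentiates the hypothesis, evaluated on the fixed vector u', in direction u. After
  -- subtracting the same identity with u and u' exchanged, the second derivatives of X and l cancel
  -- by symmetry. Symmetry for θ moves X y into the first slot.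
  have key : ∀ u u', fderiv ℝ (fderiv ℝ θ) y u (X y) u' + fderiv ℝ θ y (fderiv ℝ X y u) u' +
      (fderiv ℝ θ y u (fderiv ℝ X y u') + θ y (fderiv ℝ (fderiv ℝ X) y u u')) =
      fderiv ℝ (fderiv ℝ l) y u u' := by
    intro u u'
    have hL := ((hθ1.hasFDerivAt.clm_apply hX0).clm_apply (hasFDerivAt_const u' y)).add
      (hθ0.clm_apply (hX1.hasFDerivAt.clm_apply (hasFDerivAt_const u' y)))
    have hR := hl1.hasFDerivAt.clm_apply (hasFDerivAt_const u' y)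
    have hE := hR.congr_of_eventuallyEq (h.mono fun z hz => hz u')
    have e := congrArg (fun A => A u) (hL.unique hE)
    simp only [_root_.add_apply, ContinuousLinearMap.comp_apply,
      ContinuousLinearMap.flip_apply, _root_.zero_apply, map_zero, zero_add] at e
    linarith
  intro u u'
  have k1 := key u u'
  have k2 := key u' u
  rw [symθ (X y) u, symθ (X y) u']
  rw [symX u' u, syml u' u] at k2
  linarith

end Invariance

/-! ### Flows of vector fields on manifolds: uniqueness, concatenation, preservation of forms. -/

section ManifoldFlow
variable {F : Type*} [NormedAddCommGroup F] [NormedSpace ℝ F]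
  {HN : Type*} [TopologicalSpace HN] {J : ModelWithCorners ℝ F HN}
  {N : Type*} [TopologicalSpace N] [ChartedSpace HN N]

theorem one_smulRight_apply_one (u : F) : (1 : ℝ →L[ℝ] ℝ).smulRight u 1 = u := by simp

/-- The manifold derivative, as a linear map between the model vector spaces. -/
noncomputable def modelDeriv {F' HN' N' : Type*} [NormedAddCommGroup F'] [NormedSpace ℝ F']
    [TopologicalSpace HN'] [TopologicalSpace N'] [ChartedSpace HN' N']
    (J : ModelWithCorners ℝ F HN) (J' : ModelWithCorners ℝ F' HN') (f : N → N') (x : N) :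
    F →L[ℝ] F' := mfderiv J J' f x

theorem modelDeriv_comp {F' HN' N' F'' HN'' N'' : Type*} [NormedAddCommGroup F']
    [NormedSpace ℝ F'] [TopologicalSpace HN'] {J' : ModelWithCorners ℝ F' HN'} [TopologicalSpace N']
    [ChartedSpace HN' N'] [NormedAddCommGroup F''] [NormedSpace ℝ F''] [TopologicalSpace HN'']
    {J'' : ModelWithCorners ℝ F'' HN''} [TopologicalSpace N''] [ChartedSpace HN'' N'']
    {f : N → N'} {g : N' → N''} {x : N}
    (hg : MDifferentiableAt J' J'' g (f x)) (hf : MDifferentiableAt J J' f x) :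
    modelDeriv J J'' (g ∘ f) x = (modelDeriv J' J'' g (f x)).comp (modelDeriv J J' f x) :=
  mfderiv_comp x hg hf

theorem modelDeriv_congr {F' HN' N' : Type*} [NormedAddCommGroup F']
    [NormedSpace ℝ F'] [TopologicalSpace HN'] {J' : ModelWithCorners ℝ F' HN'} [TopologicalSpace N']
    [ChartedSpace HN' N'] {f g : N → N'} {x : N} (h : f =ᶠ[nhds x] g) :
    modelDeriv J J' f x = modelDeriv J J' g x :=
  h.mfderiv_eq

theorem modelDeriv_eq_fderiv {F' : Type*} [NormedAddCommGroup F'] [NormedSpace ℝ F'] {f : F → F'}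
    {x : F} : modelDeriv 𝓘(ℝ, F) 𝓘(ℝ, F') f x = fderiv ℝ f x :=
  mfderiv_eq_fderiv

/-- The representation of a vector field in the preferred chart at `x₀`. -/
noncomputable def chartField (v : ∀ x : N, TangentSpace J x) (x₀ : N) (y : F) : F :=
  modelDeriv J 𝓘(ℝ, F) (extChartAt J x₀) ((extChartAt J x₀).symm y) (v ((extChartAt J x₀).symm y))

theorem chartField_extChartAt (v : ∀ x : N, TangentSpace J x) {x₀ x : N}
    (hx : x ∈ (extChartAt J x₀).source) :
    chartField v x₀ (extChartAt J x₀ x) = modelDeriv J 𝓘(ℝ, F) (extChartAt J x₀) x (v x) := by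
  rw [chartField, (extChartAt J x₀).left_inv hx]

/-- Some integral curve of `v` on `[0, s]` goes from `x` to `y`. -/
def FlowRel (v : ∀ x : N, TangentSpace J x) (s : ℝ) (x y : N) : Prop :=
  ∃ γ : ℝ → N, γ 0 = x ∧ γ s = y ∧ IsMIntegralCurveOn γ v (Icc 0 s)

/-- Near `x`, the flow of `v` exists up to time `s`, it is differentiable at `x` and preserves the
form `α` there. -/
def FlowPreservesAt (v : ∀ x : N, TangentSpace J x) {k : ℕ} (α : DiffForm J N k) (s : ℝ) (x : N) :
    Prop :=
  ∃ Φ : N → N, (∀ᶠ z in nhds x, FlowRel v s z (Φ z)) ∧ MDifferentiableAt J J Φ x ∧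
    formPullback J J Φ α x = α x

theorem formPullback_comp {F' HN' N' F'' HN'' N'' : Type*} [NormedAddCommGroup F']
    [NormedSpace ℝ F'] [TopologicalSpace HN'] {J' : ModelWithCorners ℝ F' HN'} [TopologicalSpace N']
    [ChartedSpace HN' N'] [NormedAddCommGroup F''] [NormedSpace ℝ F''] [TopologicalSpace HN'']
    {J'' : ModelWithCorners ℝ F'' HN''} [TopologicalSpace N''] [ChartedSpace HN'' N'']
    {k : ℕ} (α : DiffForm J'' N'' k) {f : N → N'} {g : N' → N''} {x : N}
    (hg : MDifferentiableAt J' J'' g (f x)) (hf : MDifferentiableAt J J' f x) :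
    formPullback J J'' (g ∘ f) α x =
      (formPullback J' J'' g α (f x)).compContinuousLinearMap (mfderiv J J' f x) := by
  have h := modelDeriv_comp hg hf
  ext w
  exact congrArg (fun A : F →L[ℝ] F'' => (α (g (f x)) : F'' [⋀^Fin k]→L[ℝ] ℝ)
    (fun i => A (w i))) h

theorem formPullback_congr {F' HN' N' : Type*} [NormedAddCommGroup F']
    [NormedSpace ℝ F'] [TopologicalSpace HN'] {J' : ModelWithCorners ℝ F' HN'} [TopologicalSpace N']
    [ChartedSpace HN' N'] {k : ℕ} (α : DiffForm J' N' k) {f g : N → N'} {x : N}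
    (h : f =ᶠ[nhds x] g) : formPullback J J' f α x = formPullback J J' g α x := by
  have hx := h.self_of_nhds
  have hd := h.mfderiv_eq (I := J) (I' := J')
  -- The values of α at f x and g x lie in spaces of forms on different tangent spaces. Stated over
  -- the model space, the equality of base points can be substituted.
  have key : ∀ (y y' : N') (A A' : F →L[ℝ] F'), y = y' → A = A' → ∀ w : Fin k → F,
      (α y : F' [⋀^Fin k]→L[ℝ] ℝ) (fun i => A (w i)) =
      (α y' : F' [⋀^Fin k]→L[ℝ] ℝ) (fun i => A' (w i)) := by
    rintro _ _ _ _ rfl rfl w; rfl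
  ext w
  exact key (f x) (g x) _ _ hx hd w

theorem FlowRel.trans {v : ∀ x : N, TangentSpace J x} {s t : ℝ} (hs : 0 ≤ s) (ht : 0 ≤ t)
    {x y z : N} (h₁ : FlowRel v s x y) (h₂ : FlowRel v t y z) : FlowRel v (s + t) x z := by
  obtain ⟨γ₁, h10, h1s, h1⟩ := h₁
  obtain ⟨γ₂, h20, h2t, h2⟩ := h₂
  have h2' : IsMIntegralCurveOn (γ₂ ∘ (· - s)) v (Icc s (s + t)) := by
    have := isMIntegralCurveOn_comp_sub (dt := s).2 h2
    refine this.mono fun r hr => ⟨by linarith [hr.1], by linarith [hr.2]⟩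
  let γ : ℝ → N := fun r => if r ≤ s then γ₁ r else γ₂ (r - s)
  have e1 : EqOn γ γ₁ (Icc 0 s) := fun r hr => if_pos hr.2
  have e2 : EqOn γ (γ₂ ∘ (· - s)) (Icc s (s + t)) := by
    intro r hr
    rcases hr.1.eq_or_lt with rfl | hlt
    · simp [γ, h1s, h20]
    · simp [γ, not_le.2 hlt]
  refine ⟨γ, by rw [e1 ⟨le_rfl, hs⟩, h10], ?_, ?_⟩
  · rw [e2 ⟨by linarith, le_rfl⟩]; simp [h2t]
  · have key : ∀ (δ : ℝ → N) (A : Set ℝ), EqOn γ δ A → IsMIntegralCurveOn δ v A →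
        IsMIntegralCurveOn γ v A := by
      intro δ A he hδ r hr
      have h := hδ r hr
      have h' := h.congr_of_eventuallyEq (f₁ := γ) (he.eventuallyEq_of_mem self_mem_nhdsWithin)
        (he hr)
      rw [he hr]
      exact h'
    have k1 := key γ₁ _ e1 h1
    have k2 := key _ _ e2 h2'
    intro r hr
    rcases lt_trichotomy r s with hlt | rfl | hgt
    · refine (k1 r ⟨hr.1, hlt.le⟩).mono_of_mem_nhdsWithin ?_
      filter_upwards [self_mem_nhdsWithin, mem_nhdsWithin_of_mem_nhds (Iio_mem_nhds hlt)]
        with q hq hq' using ⟨hq.1, hq'.le⟩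
    -- At the junction time both curves have derivative v at the common point, so the two one-sided
    -- derivatives glue.
    · rw [← Icc_union_Icc_eq_Icc hs (by linarith : r ≤ r + t)]
      exact (k1 r ⟨hs, le_rfl⟩).union (k2 r ⟨le_rfl, by linarith⟩)
    · refine (k2 r ⟨hgt.le, hr.2⟩).mono_of_mem_nhdsWithin ?_
      filter_upwards [self_mem_nhdsWithin, mem_nhdsWithin_of_mem_nhds (Ioi_mem_nhds hgt)]
        with q hq hq' using ⟨hq'.le, hq.2⟩

/-- Continuity of Φ at x sends nearby initial points into the neighbourhood where the second flow
exists. The chain rule and functoriality of the pullback do the rest. The first flow map is explicit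
because the second hypothesis is based at Φ x. -/
theorem FlowPreservesAt.trans {v : ∀ x : N, TangentSpace J x} {k : ℕ} {α : DiffForm J N k}
    {s t : ℝ} (hs : 0 ≤ s) (ht : 0 ≤ t) {x : N} {Φ : N → N}
    (hΦ : ∀ᶠ z in nhds x, FlowRel v s z (Φ z)) (hd : MDifferentiableAt J J Φ x)
    (hα : formPullback J J Φ α x = α x) (h : FlowPreservesAt v α t (Φ x)) :
    FlowPreservesAt v α (s + t) x := by
  obtain ⟨Ψ, hΨ, hΨd, hΨα⟩ := h
  refine ⟨Ψ ∘ Φ, ?_, hΨd.comp x hd, ?_⟩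
  · filter_upwards [hΦ, hd.continuousAt hΨ] with z hz hz'
    exact hz.trans hs ht hz'
  · rw [formPullback_comp α hΨd hd, hΨα]
    exact hα

/-- The hypothesis of Cauchy–Lipschitz theory, formulated in charts. -/
def SmoothInCharts (v : ∀ x : N, TangentSpace J x) : Prop :=
  ∀ x₀ : N, ContDiffOn ℝ ∞ (chartField v x₀) (extChartAt J x₀).target

theorem SmoothInCharts.contDiffAt [J.Boundaryless] {v : ∀ x : N, TangentSpace J x}
    (hv : SmoothInCharts v) {x₀ : N} {y : F} (hy : y ∈ (extChartAt J x₀).target) {n : ℕ} :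
    ContDiffAt ℝ n (chartField v x₀) y :=
  ((hv x₀).contDiffAt ((isOpen_extChartAt_target x₀).mem_nhds hy)).of_le
    (by exact_mod_cast le_top)

variable [IsManifold J 1 N]

theorem hasDerivWithinAt_extChartAt_comp {v : ∀ x : N, TangentSpace J x} {x₀ : N} {γ : ℝ → N}
    {s : Set ℝ} {t : ℝ}
    (hγ : HasMFDerivWithinAt 𝓘(ℝ, ℝ) J γ s t ((1 : ℝ →L[ℝ] ℝ).smulRight (v (γ t))))
    (ht : γ t ∈ (extChartAt J x₀).source) :
    HasDerivWithinAt (extChartAt J x₀ ∘ γ) (chartField v x₀ (extChartAt J x₀ (γ t))) s t := by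
  have h1 : HasMFDerivAt J 𝓘(ℝ, F) (extChartAt J x₀) (γ t) _ :=
    (mdifferentiableAt_extChartAt (by rwa [extChartAt_source] at ht)).hasMFDerivAt
  have h := (h1.comp_hasMFDerivWithinAt t hγ).hasFDerivWithinAt
  have h' : HasFDerivWithinAt (extChartAt J x₀ ∘ γ) (((modelDeriv J 𝓘(ℝ, F) (extChartAt J x₀)
    (γ t)).comp ((1 : ℝ →L[ℝ] ℝ).smulRight (v (γ t) : F)))) s t := h
  rw [chartField_extChartAt v ht]
  exact h'.hasDerivWithinAt.congr_deriv (congrArg _ (one_smulRight_apply_one (F := F) (v (γ t))))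

variable [J.Boundaryless]

theorem mdifferentiableAt_extChartAt_symm {x₀ : N} {y : F} (hy : y ∈ (extChartAt J x₀).target) :
    MDifferentiableAt 𝓘(ℝ, F) J (extChartAt J x₀).symm y := by
  have h := mdifferentiableWithinAt_extChartAt_symm hy
  rwa [J.range_eq_univ, mdifferentiableWithinAt_univ] at h

theorem mfderiv_extChartAt_symm_apply {x₀ : N} {y : F} (hy : y ∈ (extChartAt J x₀).target)
    (w : F) :
    modelDeriv 𝓘(ℝ, F) J (extChartAt J x₀).symm y
      (modelDeriv J 𝓘(ℝ, F) (extChartAt J x₀) ((extChartAt J x₀).symm y) w) = w := by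
  have h := mfderivWithin_extChartAt_symm_comp_mfderiv_extChartAt (I := J) hy
  rw [J.range_eq_univ, mfderivWithin_univ] at h
  exact congrArg (fun A : F →L[ℝ] F => A w) h

theorem mfderiv_extChartAt_apply_symm {x₀ : N} {y : F} (hy : y ∈ (extChartAt J x₀).target)
    (w : F) :
    modelDeriv J 𝓘(ℝ, F) (extChartAt J x₀) ((extChartAt J x₀).symm y)
      (modelDeriv 𝓘(ℝ, F) J (extChartAt J x₀).symm y w) = w := by
  have h := mfderiv_extChartAt_comp_mfderivWithin_extChartAt_symm (I := J) hy
  rw [J.range_eq_univ, mfderivWithin_univ] at h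
  exact congrArg (fun A : F →L[ℝ] F => A w) h

theorem hasMFDerivWithinAt_extChartAt_symm_comp {v : ∀ x : N, TangentSpace J x} {x₀ : N} {c : ℝ → F}
    {s : Set ℝ} {t : ℝ} (hc : HasDerivWithinAt c (chartField v x₀ (c t)) s t)
    (ht : c t ∈ (extChartAt J x₀).target) :
    HasMFDerivWithinAt 𝓘(ℝ, ℝ) J ((extChartAt J x₀).symm ∘ c) s t
      ((1 : ℝ →L[ℝ] ℝ).smulRight (v ((extChartAt J x₀).symm (c t)))) := by
  have h1 := (mdifferentiableAt_extChartAt_symm ht).hasMFDerivAt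
  have h := h1.comp_hasMFDerivWithinAt t hc.hasFDerivWithinAt.hasMFDerivWithinAt
  have e : (modelDeriv 𝓘(ℝ, F) J (extChartAt J x₀).symm (c t)).comp
      (ContinuousLinearMap.toSpanSingleton ℝ (chartField v x₀ (c t))) =
      (1 : ℝ →L[ℝ] ℝ).smulRight (v ((extChartAt J x₀).symm (c t)) : F) := by
    refine ContinuousLinearMap.ext_ring ?_
    rw [ContinuousLinearMap.comp_apply, ContinuousLinearMap.toSpanSingleton_apply, one_smul]
    exact (mfderiv_extChartAt_symm_apply ht _).trans (one_smulRight_apply_one _).symm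
  exact h.congr_mfderiv e

/-- Uniqueness of integral curves. -/
theorem IsMIntegralCurveOn.eqOn_Icc [T2Space N] {v : ∀ x : N, TangentSpace J x}
    (hv : SmoothInCharts v) {γ γ' : ℝ → N} {a b : ℝ} (hγ : IsMIntegralCurveOn γ v (Icc a b))
    (hγ' : IsMIntegralCurveOn γ' v (Icc a b)) (h : γ a = γ' a) : EqOn γ γ' (Icc a b) := by
  have hcl : IsClosed ({t | γ t = γ' t} ∩ Icc a b) := by
    have := (hγ.continuousOn.prodMk hγ'.continuousOn).preimage_isClosed_of_isClosed isClosed_Icc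
      isClosed_diagonal
    rwa [inter_comm] at this
  -- The agreement set is closed because N is Hausdorff. It remains to extend agreement to the right
  -- of any time t, which is Lipschitz uniqueness in the chart at γ t.
  refine hcl.Icc_subset_of_forall_exists_gt h fun t ⟨ht, htab⟩ s hs => ?_
  have hts : t < s := hs
  have ht' : γ t = γ' t := ht
  have htI : t ∈ Icc a b := Ico_subset_Icc_self htab
  obtain ⟨K, S, hS, hlip⟩ := (hv.contDiffAt (n := 1)
    (mem_extChartAt_target (I := J) (γ t))).exists_lipschitzOnWith
  have hA : {x | x ∈ (extChartAt J (γ t)).source ∧ extChartAt J (γ t) x ∈ S} ∈ nhds (γ t) :=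
    Filter.inter_mem (extChartAt_source_mem_nhds (γ t)) (continuousAt_extChartAt (γ t) hS)
  have h1 := (hγ.continuousOn t htI) hA
  have h2 := (hγ'.continuousOn t htI) (by rwa [← ht'])
  obtain ⟨δ, hδ, hsub⟩ := Metric.mem_nhdsWithin_iff.1 (Filter.inter_mem h1 h2)
  -- Up to time r both curves remain in the chart domain and in the set where the coordinate field
  -- is Lipschitz.
  let r := min (min b s) (t + δ / 2)
  have hrt : t < r := lt_min (lt_min htab.2 hts) (by linarith)
  have hrb : r ≤ b := (min_le_left _ _).trans (min_le_left _ _)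
  have hrs : r ≤ s := (min_le_left _ _).trans (min_le_right _ _)
  have hIcc : Icc t r ⊆ Icc a b := Icc_subset_Icc htab.1 hrb
  have hmem : ∀ q ∈ Icc t r, (γ q ∈ (extChartAt J (γ t)).source ∧ extChartAt J (γ t) (γ q) ∈ S) ∧
      (γ' q ∈ (extChartAt J (γ t)).source ∧ extChartAt J (γ t) (γ' q) ∈ S) := fun q hq =>
    hsub ⟨by
      rw [Metric.mem_ball, Real.dist_eq, abs_of_nonneg (by linarith [hq.1])]
      linarith [hq.2, min_le_right (min b s) (t + δ / 2)], hIcc hq⟩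
  have d1 : ∀ q ∈ Icc t r, HasDerivWithinAt (extChartAt J (γ t) ∘ γ)
      (chartField v (γ t) (extChartAt J (γ t) (γ q))) (Icc t r) q := fun q hq =>
    hasDerivWithinAt_extChartAt_comp (hγ.mono hIcc q hq) (hmem q hq).1.1
  have d2 : ∀ q ∈ Icc t r, HasDerivWithinAt (extChartAt J (γ t) ∘ γ')
      (chartField v (γ t) (extChartAt J (γ t) (γ' q))) (Icc t r) q := fun q hq =>
    hasDerivWithinAt_extChartAt_comp (hγ'.mono hIcc q hq) (hmem q hq).2.1
  have huniq := ODE_solution_unique_of_mem_Icc_right (K := K) (s := fun _ => S)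
    (v := fun _ => chartField v (γ t)) (fun _ _ => hlip)
    (fun q hq => (d1 q hq).continuousWithinAt)
    (fun q hq => hasDerivWithinAt_Ici_of_Icc (d1 q (Ico_subset_Icc_self hq)) hq)
    (fun q hq => (hmem q (Ico_subset_Icc_self hq)).1.2)
    (fun q hq => (d2 q hq).continuousWithinAt)
    (fun q hq => hasDerivWithinAt_Ici_of_Icc (d2 q (Ico_subset_Icc_self hq)) hq)
    (fun q hq => (hmem q (Ico_subset_Icc_self hq)).2.2) (by simp [ht'])
  have hr : r ∈ Icc t r := ⟨hrt.le, le_rfl⟩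
  exact ⟨r, (extChartAt J (γ t)).injOn (hmem r hr).1.1 (hmem r hr).2.1 (huniq hr), hrt, hrs⟩

theorem FlowRel.unique [T2Space N] {v : ∀ x : N, TangentSpace J x} (hv : SmoothInCharts v)
    {s : ℝ} (hs : 0 ≤ s) {x y y' : N} (h : FlowRel v s x y) (h' : FlowRel v s x y') : y = y' := by
  obtain ⟨γ, h0, hs1, hγ⟩ := h
  obtain ⟨γ', h0', hs1', hγ'⟩ := h'
  rw [← hs1, ← hs1']
  exact IsMIntegralCurveOn.eqOn_Icc hv hγ hγ' (h0.trans h0'.symm) ⟨hs, le_rfl⟩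

/-- Infinitesimal invariance of a two-form under the flow of a vector field, formulated in charts:
the form is given by the alternating part of a field `g` of bilinear forms whose Lie derivative
vanishes. -/
def InvariantInCharts (v : ∀ x : N, TangentSpace J x) (α : DiffForm J N 2) : Prop :=
  ∀ x₀ : N, ∃ g : F → F →L[ℝ] F →L[ℝ] ℝ,
    (∀ y ∈ (extChartAt J x₀).target, DifferentiableAt ℝ g y) ∧
    (∀ y ∈ (extChartAt J x₀).target, LieDerivAltZeroAt (chartField v x₀) g y) ∧
    ∀ x ∈ (extChartAt J x₀).source, ∀ w : Fin 2 → F,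
      (α x : F [⋀^Fin 2]→L[ℝ] ℝ) w =
        g (extChartAt J x₀ x) (modelDeriv J 𝓘(ℝ, F) (extChartAt J x₀) x (w 0))
          (modelDeriv J 𝓘(ℝ, F) (extChartAt J x₀) x (w 1)) -
        g (extChartAt J x₀ x) (modelDeriv J 𝓘(ℝ, F) (extChartAt J x₀) x (w 1))
          (modelDeriv J 𝓘(ℝ, F) (extChartAt J x₀) x (w 0))

/-- The coordinate flow in the chart at x₀ is carried back to N. Its derivative is V, along which
the alternating form is constant. The time ε is uniform near x₀, which the later compactness
argument needs. -/
theorem exists_flowPreservesAt_nhds [CompleteSpace F] {v : ∀ x : N, TangentSpace J x}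
    (hv : SmoothInCharts v) {α : DiffForm J N 2} (hα : InvariantInCharts v α) (x₀ : N) :
    ∃ ε > 0, ∀ᶠ x in nhds x₀, ∀ s ∈ Icc 0 ε, FlowPreservesAt v α s x := by
  obtain ⟨g, hgd, hgL, hgα⟩ := hα x₀
  obtain ⟨ε, hε, U, hU, A, V, hflow⟩ := exists_local_flow
    (hv.contDiffAt (n := 2) (mem_extChartAt_target (I := J) x₀)) (extChartAt_target_mem_nhds x₀)
  -- The doubled neighbourhood filter makes `U` a neighbourhood of the image of each nearby x, so
  -- that the flow exists around x and not only at x.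
  have hU' := (continuousAt_extChartAt (I := J) x₀).eventually (eventually_eventually_nhds.2 hU)
  refine ⟨ε, hε, ?_⟩
  filter_upwards [hU', extChartAt_source_mem_nhds (I := J) x₀] with x hxU hx s hs
  have hφ : MDifferentiableAt J 𝓘(ℝ, F) (extChartAt J x₀) x :=
    mdifferentiableAt_extChartAt (by rwa [extChartAt_source] at hx)
  have hev : ∀ᶠ z in nhds x, extChartAt J x₀ z ∈ U ∧ z ∈ (extChartAt J x₀).source :=
    (hφ.continuousAt.eventually hxU).and ((isOpen_extChartAt_source x₀).mem_nhds hx)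
  have hfx := hflow _ hev.self_of_nhds.1
  have hT := (hfx.2.2 s hs).1
  have hsymm := mdifferentiableAt_extChartAt_symm hT
  have hA : MDifferentiableAt 𝓘(ℝ, F) 𝓘(ℝ, F) (fun z => A z s) (extChartAt J x₀ x) :=
    (hfx.2.2 s hs).2.2.2.differentiableAt.mdifferentiableAt
  let Φ : N → N := (extChartAt J x₀).symm ∘ ((fun z => A z s) ∘ extChartAt J x₀)
  have hA' : MDifferentiableAt J 𝓘(ℝ, F) ((fun z => A z s) ∘ extChartAt J x₀) x := hA.comp x hφ
  have hd : ∀ w : F, modelDeriv J J Φ x w =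
      modelDeriv 𝓘(ℝ, F) J (extChartAt J x₀).symm (A (extChartAt J x₀ x) s)
        (V (extChartAt J x₀ x) s (modelDeriv J 𝓘(ℝ, F) (extChartAt J x₀) x w)) := by
    intro w
    have e1 := modelDeriv_comp (f := (fun z => A z s) ∘ extChartAt J x₀)
      (g := (extChartAt J x₀).symm) hsymm hA'
    have e2 := modelDeriv_comp hA hφ
    rw [modelDeriv_eq_fderiv, (hfx.2.2 s hs).2.2.2.fderiv] at e2
    rw [e2] at e1
    exact congrArg (fun B : F →L[ℝ] F => B w) e1
  refine ⟨Φ, ?_, hsymm.comp x hA', ?_⟩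
  · filter_upwards [hev] with z hz
    obtain ⟨h0, -, hz'⟩ := hflow _ hz.1
    have hsub : Icc 0 s ⊆ Icc 0 ε := Icc_subset_Icc le_rfl hs.2
    refine ⟨(extChartAt J x₀).symm ∘ A (extChartAt J x₀ z), ?_, rfl, fun t ht => ?_⟩
    · simp only [Function.comp_apply, h0]
      exact (extChartAt J x₀).left_inv hz.2
    · exact hasMFDerivWithinAt_extChartAt_symm_comp ((hz' t (hsub ht)).2.1.mono hsub)
        (hz' t (hsub ht)).1
  · have hΦx : Φ x ∈ (extChartAt J x₀).source := (extChartAt J x₀).map_target hT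
    have hφΦ : extChartAt J x₀ (Φ x) = A (extChartAt J x₀ x) s := (extChartAt J x₀).right_inv hT
    have hdd : ∀ w : F, modelDeriv J 𝓘(ℝ, F) (extChartAt J x₀) (Φ x)
        (modelDeriv J J Φ x w) =
        V (extChartAt J x₀ x) s (modelDeriv J 𝓘(ℝ, F) (extChartAt J x₀) x w) := by
      intro w
      rw [hd w]
      exact mfderiv_extChartAt_apply_symm hT _
    have main : ∀ w : Fin 2 → F,
        (α (Φ x) : F [⋀^Fin 2]→L[ℝ] ℝ) (fun i => modelDeriv J J Φ x (w i)) =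
        (α x : F [⋀^Fin 2]→L[ℝ] ℝ) w := fun w => by
      have hconst := alternating_const_along_flow hgd hgL (fun t ht => (hfx.2.2 t ht).1)
        (fun t ht => (hfx.2.2 t ht).2.1) (fun t ht => (hfx.2.2 t ht).2.2.1)
        (modelDeriv J 𝓘(ℝ, F) (extChartAt J x₀) x (w 0))
        (modelDeriv J 𝓘(ℝ, F) (extChartAt J x₀) x (w 1)) s hs
      rw [hgα (Φ x) hΦx (fun i => modelDeriv J J Φ x (w i)), hdd, hdd, hφΦ, hconst, hfx.1, hfx.2.1,
        hgα x hx w]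
      rfl
    exact ContinuousAlternatingMap.ext main

/-- The flow of an infinitesimally invariant vector field preserves the form, up to any time at
which it exists. -/
theorem FlowRel.flowPreservesAt [CompleteSpace F] [T2Space N] {v : ∀ x : N, TangentSpace J x}
    (hv : SmoothInCharts v) {α : DiffForm J N 2} (hα : InvariantInCharts v α) {s : ℝ} (hs : 0 ≤ s)
    {x y : N} (h : FlowRel v s x y) : FlowPreservesAt v α s x := by
  obtain ⟨γ, h0, -, hγ⟩ := h
  have hcomp : IsCompact (γ '' Icc 0 s) := isCompact_Icc.image_of_continuousOn hγ.continuousOn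
  obtain ⟨ε, hε, hloc⟩ : ∃ ε > 0, ∀ z ∈ γ '' Icc 0 s, ∀ t ∈ Icc 0 ε, FlowPreservesAt v α t z := by
    -- Compactness of the trajectory turns the locally uniform times into a single step size ε.
    refine hcomp.induction_on (p := fun S => ∃ ε > 0, ∀ z ∈ S, ∀ t ∈ Icc 0 ε,
      FlowPreservesAt v α t z) ⟨1, one_pos, by simp⟩ ?_ ?_ ?_
    · rintro S S' hSS ⟨ε, hε, h⟩
      exact ⟨ε, hε, fun z hz => h z (hSS hz)⟩
    · rintro S S' ⟨ε, hε, h⟩ ⟨ε', hε', h'⟩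
      refine ⟨min ε ε', lt_min hε hε', fun z hz t ht => ?_⟩
      rcases hz with hz | hz
      · exact h z hz t ⟨ht.1, ht.2.trans (min_le_left _ _)⟩
      · exact h' z hz t ⟨ht.1, ht.2.trans (min_le_right _ _)⟩
    · intro z _
      obtain ⟨ε, hε, h⟩ := exists_flowPreservesAt_nhds hv hα z
      exact ⟨_, mem_nhdsWithin_of_mem_nhds h, ε, hε, fun z hz => hz⟩
  have hrel : ∀ r ∈ Icc 0 s, FlowRel v r x (γ r) := fun r hr =>
    ⟨γ, h0, rfl, hγ.mono (Icc_subset_Icc le_rfl hr.2)⟩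
  -- Induction on the number of steps: a time r exceeding ε is split as r - ε followed by a full
  -- step ε. The statement ranges over all r ≤ n ε, so r itself need not be a multiple of ε.
  have key : ∀ n : ℕ, ∀ r ∈ Icc 0 s, r ≤ n * ε → FlowPreservesAt v α r x := by
    intro n
    induction n with
    | zero =>
      intro r hr hrn
      have hr0 : r = 0 := le_antisymm (by simpa using hrn) hr.1
      subst hr0
      exact hloc x ⟨0, hr, h0⟩ 0 ⟨le_rfl, hε.le⟩
    | succ n ih =>
      intro r hr hrn
      rcases le_or_gt r ε with hrε | hrε
      · exact hloc x ⟨0, ⟨le_rfl, hs⟩, h0⟩ r ⟨hr.1, hrε⟩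
      · have hr' : r - ε ∈ Icc 0 s := ⟨by linarith, by linarith [hr.2]⟩
        obtain ⟨Φ, hΦ, hd, hp⟩ := ih (r - ε) hr' (by push_cast at hrn; linarith)
        -- The flow map from the induction hypothesis is only known abstractly. Uniqueness places Φ
        -- x on the compact trajectory, where the step size ε is available.
        have e : Φ x = γ (r - ε) := FlowRel.unique hv hr'.1 hΦ.self_of_nhds (hrel _ hr')
        have := FlowPreservesAt.trans hr'.1 hε.le hΦ hd hp
          (hloc (Φ x) ⟨r - ε, hr', e.symm⟩ ε ⟨hε.le, le_rfl⟩)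
        rwa [sub_add_cancel] at this
  obtain ⟨n, hn⟩ := exists_nat_ge (s / ε)
  exact key n s ⟨hs, le_rfl⟩ ((div_le_iff₀ hε).1 hn)

end ManifoldFlow

/-! ### The left-invariant frame and coframe in a chart, and the structure equation. -/

section GroupCoordinates
variable {E : Type*} [NormedAddCommGroup E] [NormedSpace ℝ E]
  {H : Type*} [TopologicalSpace H] {I : ModelWithCorners ℝ E H}
  {G : Type*} [TopologicalSpace G] [ChartedSpace H G] [Group G]

variable (I) in
/-- `ξ ↦ g ξ` as an endomorphism of the model space. -/
noncomputable def leftMulModel (g : G) : E →L[ℝ] E := leftMul I g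

variable (I) in
/-- `v ↦ g⁻¹ v` as an endomorphism of the model space. -/
noncomputable def leftMulInvModel (g : G) : E →L[ℝ] E := leftMulInv I g

variable (I) in
/-- The left-invariant frame in the chart at `g₀`. -/
noncomputable def groupFrame (g₀ : G) (q : E) : E →L[ℝ] E :=
  (modelDeriv I 𝓘(ℝ, E) (extChartAt I g₀) ((extChartAt I g₀).symm q)).comp
    (leftMulModel I ((extChartAt I g₀).symm q))

variable (I) in
/-- The left-invariant coframe in the chart at `g₀`. -/
noncomputable def groupCoframe (g₀ : G) (q : E) : E →L[ℝ] E :=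
  (leftMulInvModel I ((extChartAt I g₀).symm q)).comp
    (modelDeriv 𝓘(ℝ, E) I (extChartAt I g₀).symm q)

variable [LieGroup I ∞ G]

/-- The tangent bundle trivialization is built from chart derivatives. This identity translates
smoothness of bundle maps into smoothness of the coordinate frame and coframe. -/
theorem trivializationAt_snd_eq {g₀ g : G} (hg : g ∈ (extChartAt I g₀).source) (v : E) :
    (trivializationAt E (TangentSpace I) g₀ (⟨g, v⟩ : TangentBundle I G)).2 =
      modelDeriv I 𝓘(ℝ, E) (extChartAt I g₀) g v := by
  have := IsManifold.of_le (I := I) (M := G) (m := 1) (n := ∞) (by simp)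
  have hg' : g ∈ (chartAt H g₀).source := by rwa [extChartAt_source] at hg
  have h := TangentBundle.continuousLinearMapAt_trivializationAt (I := I) (𝕜 := ℝ) hg'
  refine Eq.trans ?_ (congrArg (fun A : E →L[ℝ] E => A v) h)
  have hb : g ∈ (trivializationAt E (TangentSpace I) g₀).baseSet := by
    simpa using hg'
  exact (congrFun ((trivializationAt E (TangentSpace I) g₀).coe_linearMapAt_of_mem (R := ℝ) hb)
    v).symm

variable [I.Boundaryless]

theorem groupCoframe_groupFrame {g₀ : G} {q : E} (hq : q ∈ (extChartAt I g₀).target) (w : E) :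
    groupCoframe I g₀ q (groupFrame I g₀ q w) = w := by
  have := IsManifold.of_le (I := I) (M := G) (m := 1) (n := ∞) (by simp)
  simp only [groupCoframe, groupFrame, ContinuousLinearMap.comp_apply]
  rw [mfderiv_extChartAt_symm_apply hq]
  exact leftMulInv_leftMul (I := I) (G := G) ((extChartAt I g₀).symm q) w

theorem groupFrame_groupCoframe {g₀ : G} {q : E} (hq : q ∈ (extChartAt I g₀).target) (w : E) :
    groupFrame I g₀ q (groupCoframe I g₀ q w) = w := by
  have := IsManifold.of_le (I := I) (M := G) (m := 1) (n := ∞) (by simp)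
  simp only [groupCoframe, groupFrame, ContinuousLinearMap.comp_apply]
  have h := leftMul_leftMulInv (I := I) ((extChartAt I g₀).symm q)
    (modelDeriv 𝓘(ℝ, E) I (extChartAt I g₀).symm q w)
  exact (congrArg _ h).trans (mfderiv_extChartAt_apply_symm hq w)

theorem contMDiffAt_extChartAt_symm {g₀ : G} {q : E} (hq : q ∈ (extChartAt I g₀).target) :
    ContMDiffAt 𝓘(ℝ, E) I ∞ (extChartAt I g₀).symm q :=
  (contMDiffOn_extChartAt_symm g₀).contMDiffAt ((isOpen_extChartAt_target g₀).mem_nhds hq)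

/-- In finite dimension, smoothness of an operator-valued map can be tested on each fixed vector ξ.
There it is smoothness of (g, ξ) ↦ gξ, read in the trivialization at g₀. -/
theorem contDiffOn_groupFrame [FiniteDimensional ℝ E] (g₀ : G) :
    ContDiffOn ℝ ∞ (groupFrame I g₀) (extChartAt I g₀).target := by
  rw [contDiffOn_clm_apply]
  intro ξ q hq
  refine ContDiffAt.contDiffWithinAt ?_
  rw [← contMDiffAt_iff_contDiffAt]
  have h1 : ContMDiffAt 𝓘(ℝ, E) I.tangent ∞ (fun q => (⟨(extChartAt I g₀).symm q,
      leftMul I ((extChartAt I g₀).symm q) ξ⟩ : TangentBundle I G)) q :=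
    (contMDiff_leftMul (I := I) (G := G)).contMDiffAt.comp q
      ((contMDiffAt_extChartAt_symm hq).prodMk contMDiffAt_const)
  have hs : (extChartAt I g₀).symm q ∈ (chartAt H g₀).source := by
    have := (extChartAt I g₀).map_target hq
    rwa [extChartAt_source] at this
  have h2 := ((trivializationAt E (TangentSpace I) g₀).contMDiffAt_iff (by
    rw [Trivialization.mem_source]; simpa using hs)).1 h1
  refine h2.2.congr_of_eventuallyEq ?_
  filter_upwards [(isOpen_extChartAt_target (I := I) g₀).mem_nhds hq] with q' hq'
  exact (trivializationAt_snd_eq ((extChartAt I g₀).map_target hq') _).symm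

theorem contDiffOn_groupCoframe [FiniteDimensional ℝ E] (g₀ : G) :
    ContDiffOn ℝ ∞ (groupCoframe I g₀) (extChartAt I g₀).target := by
  have := IsManifold.of_le (I := I) (M := G) (m := 1) (n := ∞) (by simp)
  rw [contDiffOn_clm_apply]
  intro w q hq
  refine ContDiffAt.contDiffWithinAt ?_
  rw [← contMDiffAt_iff_contDiffAt]
  have hs : (extChartAt I g₀).symm q ∈ (chartAt H g₀).source := by
    have := (extChartAt I g₀).map_target hq
    rwa [extChartAt_source] at this
  -- The coordinate field with constant components w is a smooth section, because its expression in
  -- the trivialization is the constant w.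
  have h1 : ContMDiffAt 𝓘(ℝ, E) I.tangent ∞ (fun q => (⟨(extChartAt I g₀).symm q,
      modelDeriv 𝓘(ℝ, E) I (extChartAt I g₀).symm q w⟩ : TangentBundle I G)) q := by
    refine ((trivializationAt E (TangentSpace I) g₀).contMDiffAt_iff (by
      rw [Trivialization.mem_source]; simpa using hs)).2 ⟨contMDiffAt_extChartAt_symm hq, ?_⟩
    refine (contMDiffAt_const (c := w)).congr_of_eventuallyEq ?_
    filter_upwards [(isOpen_extChartAt_target (I := I) g₀).mem_nhds hq] with q' hq'
    rw [trivializationAt_snd_eq ((extChartAt I g₀).map_target hq')]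
    exact mfderiv_extChartAt_apply_symm hq' w
  have h2 := ContMDiffAt.comp (I' := I.tangent) q
    ((contMDiff_leftMulInv (I := I) (G := G)).contMDiffAt) h1
  exact h2.snd

/-- Differentiate B(q) A(q) w = w, valid on the open chart target. -/
theorem fderiv_groupCoframe_groupFrame [FiniteDimensional ℝ E] {g₀ : G} {q : E}
    (hq : q ∈ (extChartAt I g₀).target) (u w : E) :
    fderiv ℝ (groupCoframe I g₀) q u (groupFrame I g₀ q w) =
      - groupCoframe I g₀ q (fderiv ℝ (groupFrame I g₀) q u w) := by
  have hn := (isOpen_extChartAt_target (I := I) g₀).mem_nhds hq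
  have hA := (((contDiffOn_groupFrame (I := I) g₀).contDiffAt hn).differentiableAt
    (by simp)).hasFDerivAt
  have hB := (((contDiffOn_groupCoframe (I := I) g₀).contDiffAt hn).differentiableAt
    (by simp)).hasFDerivAt
  have h := hB.clm_apply (hA.clm_apply (hasFDerivAt_const w q))
  have h0 : HasFDerivAt (fun q => groupCoframe I g₀ q (groupFrame I g₀ q w)) (0 : E →L[ℝ] E) q :=
    (hasFDerivAt_const w q).congr_of_eventuallyEq (by
      filter_upwards [hn] with q' hq' using groupCoframe_groupFrame hq' w)
  have e := congrArg (fun A : E →L[ℝ] E => A u) (h.unique h0)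
  simp only [_root_.add_apply, ContinuousLinearMap.comp_apply, ContinuousLinearMap.flip_apply,
    _root_.zero_apply, map_zero, zero_add] at e
  rw [eq_neg_iff_add_eq_zero, add_comm]
  exact e

/-- The structure equation: the Lie bracket in terms of the left-invariant frame. -/
theorem groupFrame_bracket [FiniteDimensional ℝ E] {g₀ : G} {q : E}
    (hq : q ∈ (extChartAt I g₀).target) (ξ η : GroupLieAlgebra I G) :
    groupFrame I g₀ q (⁅ξ, η⁆ : GroupLieAlgebra I G) =
      fderiv ℝ (groupFrame I g₀) q (groupFrame I g₀ q ξ) η -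
        fderiv ℝ (groupFrame I g₀) q (groupFrame I g₀ q η) ξ := by
  have := IsManifold.of_le (I := I) (M := G) (m := 1) (n := ∞) (by simp)
  have : CompleteSpace E := FiniteDimensional.complete ℝ E
  have : LieGroup I (minSmoothness ℝ 3) G := by
    rw [minSmoothness_of_isRCLikeNormedField]
    infer_instance
  have hn := (isOpen_extChartAt_target (I := I) g₀).mem_nhds hq
  -- In the chart the left-invariant field of ζ is q ↦ A(q) ζ. Naturality of the Lie bracket under
  -- pullback then reduces the claim to the bracket DW·V - DV·W of fields on E.
  have hinv : ∀ ζ : GroupLieAlgebra I G, ∀ q' ∈ (extChartAt I g₀).target,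
      VectorField.mpullback 𝓘(ℝ, E) I (extChartAt I g₀).symm (mulInvariantVectorField ζ) q' =
        groupFrame I g₀ q' ζ := by
    intro ζ q' hq'
    rw [VectorField.mpullback_apply]
    have e : (modelDeriv 𝓘(ℝ, E) I (extChartAt I g₀).symm q').inverse =
        modelDeriv I 𝓘(ℝ, E) (extChartAt I g₀) ((extChartAt I g₀).symm q') :=
      ContinuousLinearMap.inverse_eq
        (ContinuousLinearMap.ext fun w => mfderiv_extChartAt_symm_apply hq' w)
        (ContinuousLinearMap.ext fun w => mfderiv_extChartAt_apply_symm hq' w)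
    exact congrArg (fun A : E →L[ℝ] E => A (mulInvariantVectorField ζ _)) e
  have hbr := VectorField.mpullback_mlieBracket (I := 𝓘(ℝ, E)) (I' := I)
    (f := (extChartAt I g₀).symm) (x₀ := q) (n := ∞)
    (mdifferentiableAt_mulInvariantVectorField ξ)
    (mdifferentiableAt_mulInvariantVectorField η)
    (contMDiffAt_extChartAt_symm hq) (by
      rw [minSmoothness_of_isRCLikeNormedField]; exact WithTop.coe_le_coe.2 le_top)
  have hL : VectorField.mpullback 𝓘(ℝ, E) I (extChartAt I g₀).symm
      (VectorField.mlieBracket I (mulInvariantVectorField ξ) (mulInvariantVectorField η)) q =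
      groupFrame I g₀ q (⁅ξ, η⁆ : GroupLieAlgebra I G) := by
    rw [← mulInvariantVector_mlieBracket, hinv _ q hq]
    rfl
  have hcongr : ∀ ζ : GroupLieAlgebra I G,
      VectorField.mpullback 𝓘(ℝ, E) I (extChartAt I g₀).symm (mulInvariantVectorField ζ)
        =ᶠ[nhds q] fun q' => groupFrame I g₀ q' ζ := fun ζ => by
    filter_upwards [hn] with q' hq' using hinv ζ q' hq'
  rw [hL, (hcongr ξ).mlieBracket_vectorField_eq (hcongr η)] at hbr
  have hE : ∀ V W : ∀ x : E, TangentSpace 𝓘(ℝ, E) x, VectorField.mlieBracket 𝓘(ℝ, E) V W q =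
      fderiv ℝ (F := E) W q (V q) - fderiv ℝ (F := E) V q (W q) := fun V W => by
    have h := (VectorField.mlieBracketWithin_univ (V := V) (W := W)).symm.trans
      (VectorField.mlieBracketWithin_eq_lieBracketWithin.trans VectorField.lieBracketWithin_univ)
    exact congrFun h q
  have hA := ((contDiffOn_groupFrame (I := I) g₀).contDiffAt hn).differentiableAt (by simp)
  have hd : ∀ ζ u : E, fderiv ℝ (fun q' => groupFrame I g₀ q' ζ) q u =
      fderiv ℝ (groupFrame I g₀) q u ζ := fun ζ u => by
    rw [(hA.hasFDerivAt.clm_apply (hasFDerivAt_const ζ q)).fderiv]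
    simp
  exact (hbr.trans (hE _ _)).trans (congrArg₂ (fun a b : E => a - b) (hd η _) (hd ξ _))

end GroupCoordinates

/-! ### The Lie derivative of the trivialized canonical one-form. -/

section Calculus
variable {E : Type*} [NormedAddCommGroup E] [NormedSpace ℝ E]

/-- The one-form `μ (B q dq)` on `E × E*`. -/
noncomputable def coframeOneForm (B : E → E →L[ℝ] E) (y : E × (E →L[ℝ] ℝ)) :
    E × (E →L[ℝ] ℝ) →L[ℝ] ℝ :=
  (y.2.comp (B y.1)).comp (ContinuousLinearMap.fst ℝ E (E →L[ℝ] ℝ))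

theorem coframeOneForm_apply (B : E → E →L[ℝ] E) (y u : E × (E →L[ℝ] ℝ)) :
    coframeOneForm B y u = y.2 (B y.1 u.1) := rfl

theorem fderiv_coframeOneForm {B : E → E →L[ℝ] E} {y : E × (E →L[ℝ] ℝ)}
    (hB : DifferentiableAt ℝ B y.1) (w u : E × (E →L[ℝ] ℝ)) :
    fderiv ℝ (coframeOneForm B) y w u = w.2 (B y.1 u.1) + y.2 (fderiv ℝ B y.1 w.1 u.1) := by
  have hB' : HasFDerivAt (fun z : E × (E →L[ℝ] ℝ) => B z.1)
      ((fderiv ℝ B y.1).comp (ContinuousLinearMap.fst ℝ E (E →L[ℝ] ℝ))) y :=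
    HasFDerivAt.comp y hB.hasFDerivAt hasFDerivAt_fst
  have hd : DifferentiableAt ℝ (coframeOneForm B) y :=
    (differentiableAt_snd.clm_comp hB'.differentiableAt).clm_comp (differentiableAt_const _)
  have h1 : HasFDerivAt (fun z => coframeOneForm B z u)
      ((fderiv ℝ (coframeOneForm B) y).flip u) y := by
    refine (hd.hasFDerivAt.clm_apply (hasFDerivAt_const u y)).congr_fderiv ?_
    ext <;> simp
  have h2 := (hasFDerivAt_snd (𝕜 := ℝ) (p := y)).clm_apply
    (hB'.clm_apply (hasFDerivAt_const u.1 y))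
  have e := congrArg (fun A : E × (E →L[ℝ] ℝ) →L[ℝ] ℝ => A w) (h1.unique h2)
  simp only [ContinuousLinearMap.flip_apply, _root_.add_apply, ContinuousLinearMap.comp_apply,
    _root_.zero_apply, map_zero, zero_add, ContinuousLinearMap.coe_fst',
    ContinuousLinearMap.coe_snd'] at e
  rw [e, add_comm]

/-- The Lie derivative of the canonical one-form along the trivialized Hamilton–Pontryagin vector
field is the differential of the Lagrangian. -/
theorem lieDeriv_coframeOneForm {A B : E → E →L[ℝ] E} {l : E × E → ℝ}
    {x : E × (E →L[ℝ] ℝ) → E} {m : E × (E →L[ℝ] ℝ) → E →L[ℝ] ℝ} {y : E × (E →L[ℝ] ℝ)}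
    {br : E → E}
    (hA : DifferentiableAt ℝ A y.1) (hB : DifferentiableAt ℝ B y.1) (hx : DifferentiableAt ℝ x y)
    (hm : DifferentiableAt ℝ m y) (hl : DifferentiableAt ℝ l (y.1, x y))
    (hAB : ∀ w, A y.1 (B y.1 w) = w) (hBA : ∀ w, B y.1 (A y.1 w) = w)
    (hdB : ∀ u w, fderiv ℝ B y.1 u (A y.1 w) = - B y.1 (fderiv ℝ A y.1 u w))
    (hbr : ∀ η, A y.1 (br η) = fderiv ℝ A y.1 (A y.1 (x y)) η - fderiv ℝ A y.1 (A y.1 η) (x y))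
    (hleg : ∀ η, fderiv ℝ l (y.1, x y) (0, η) = y.2 η)
    (hmy : ∀ η, m y η = y.2 (br η) + fderiv ℝ l (y.1, x y) (A y.1 η, 0))
    (u : E × (E →L[ℝ] ℝ)) :
    fderiv ℝ (coframeOneForm B) y (A y.1 (x y), m y) u +
      coframeOneForm B y (fderiv ℝ (fun z => (A z.1 (x z), m z)) y u) =
        fderiv ℝ (fun z => l (z.1, x z)) y u := by
  have hA' : HasFDerivAt (fun z : E × (E →L[ℝ] ℝ) => A z.1)
      ((fderiv ℝ A y.1).comp (ContinuousLinearMap.fst ℝ E (E →L[ℝ] ℝ))) y :=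
    HasFDerivAt.comp y hA.hasFDerivAt hasFDerivAt_fst
  have hX := (hA'.clm_apply hx.hasFDerivAt).prodMk hm.hasFDerivAt
  have hL : HasFDerivAt (fun z => l (z.1, x z)) _ y :=
    HasFDerivAt.comp y hl.hasFDerivAt (hasFDerivAt_fst.prodMk hx.hasFDerivAt)
  rw [hX.fderiv, hL.fderiv, fderiv_coframeOneForm hB, coframeOneForm_apply]
  -- The position part of u is written in the frame as A η. The left side then reads m η - μ(br η) +
  -- μ(Dx u): the derivatives of A and B combine into the bracket by the structure equation. The
  -- force equation turns the first two terms into the position derivative of l, and the Legendre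
  -- condition turns the last into its velocity derivative.
  obtain ⟨η, hη⟩ : ∃ η, A y.1 η = u.1 := ⟨_, hAB u.1⟩
  have hsplit : fderiv ℝ l (y.1, x y) (u.1, fderiv ℝ x y u) =
      fderiv ℝ l (y.1, x y) (u.1, 0) + y.2 (fderiv ℝ x y u) := by
    rw [← hleg, ← map_add]; simp
  have hb : y.2 (br η) = y.2 (B y.1 (fderiv ℝ A y.1 (A y.1 (x y)) η)) -
      y.2 (B y.1 (fderiv ℝ A y.1 (A y.1 η) (x y))) := by
    rw [← map_sub, ← map_sub, ← hbr, hBA]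
  simp only [ContinuousLinearMap.comp_apply, ContinuousLinearMap.prod_apply, _root_.add_apply,
    ContinuousLinearMap.flip_apply, ContinuousLinearMap.coe_fst', hsplit, map_add, hBA]
  rw [← hη, hBA, hmy, hdB, hb, map_neg]
  ring

end Calculus

/-! ### Charts of a product with a vector space, whose own chart is the identity. -/

section ProductCharts
variable {E : Type*} [NormedAddCommGroup E] [NormedSpace ℝ E]
  {H : Type*} [TopologicalSpace H] {I : ModelWithCorners ℝ E H}
  {G : Type*} [TopologicalSpace G] [ChartedSpace H G]
  {V : Type*} [NormedAddCommGroup V] [NormedSpace ℝ V]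

theorem extChartAt_prod_model_target (n₀ : G × V) :
    (extChartAt (I.prod 𝓘(ℝ, V)) n₀).target = (extChartAt I n₀.1).target ×ˢ univ := by
  rw [extChartAt_prod, PartialEquiv.prod_target, extChartAt_model_space_eq_id,
    PartialEquiv.refl_target]

theorem extChartAt_prod_model_source (n₀ : G × V) :
    (extChartAt (I.prod 𝓘(ℝ, V)) n₀).source = (extChartAt I n₀.1).source ×ˢ univ := by
  rw [extChartAt_prod, PartialEquiv.prod_source, extChartAt_model_space_eq_id,
    PartialEquiv.refl_source]

theorem modelDeriv_extChartAt_prod_model [IsManifold I 1 G] {n₀ n : G × V}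
    (hn : n.1 ∈ (extChartAt I n₀.1).source) (w : E × V) :
    modelDeriv (I.prod 𝓘(ℝ, V)) 𝓘(ℝ, E × V) (extChartAt (I.prod 𝓘(ℝ, V)) n₀) n w =
      (modelDeriv I 𝓘(ℝ, E) (extChartAt I n₀.1) n.1 w.1, w.2) := by
  have hφ : HasMFDerivAt I 𝓘(ℝ, E) (extChartAt I n₀.1) n.1 _ :=
    (mdifferentiableAt_extChartAt (by rwa [extChartAt_source] at hn)).hasMFDerivAt
  have h1 := HasMFDerivAt.comp n hφ (hasMFDerivAt_fst (I := I) (I' := 𝓘(ℝ, V)) n)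
  have h2 := hasMFDerivAt_snd (I := I) (I' := 𝓘(ℝ, V)) n
  have h3 : HasMFDerivAt (I.prod 𝓘(ℝ, V)) 𝓘(ℝ, E × V) (extChartAt (I.prod 𝓘(ℝ, V)) n₀) n
      (((modelDeriv I 𝓘(ℝ, E) (extChartAt I n₀.1) n.1).comp
        (ContinuousLinearMap.fst ℝ E V)).prod (ContinuousLinearMap.snd ℝ E V)) :=
    ⟨h1.1.prodMk h2.1, h1.2.prodMk h2.2⟩
  exact congrArg (fun A : E × V →L[ℝ] E × V => A w) h3.mfderiv

end ProductCharts

/-! ### The HP vector field on G × 𝔤*: smoothness and infinitesimal invariance. -/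

section HPField
variable {E : Type*} [NormedAddCommGroup E] [NormedSpace ℝ E]
  {H : Type*} [TopologicalSpace H] {I : ModelWithCorners ℝ E H}
  {G : Type*} [TopologicalSpace G] [ChartedSpace H G] [Group G] [LieGroup I ∞ G]

/-- A smooth solution `ξ = X (g, μ)` of `μ = ∂ℓ/∂ξ (g, ξ)`. -/
structure IsVelocity (L : Lagrangian I G) (X : G × (E →L[ℝ] ℝ) → E) : Prop where
  smooth : ContMDiff (I.prod 𝓘(ℝ, E →L[ℝ] ℝ)) 𝓘(ℝ, E) ∞ X
  legendre : ∀ n, dLagrangian_dξ L n.1 (X n) = n.2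
  velocity : ∀ g ξ, X (g, dLagrangian_dξ L g ξ) = ξ

/-- X is the inverse Legendre transform conjugated by left trivializations: send (g, μ) to (g, gμ),
apply `Φ.symm`, and translate the resulting vector back by g⁻¹. -/
theorem Hyperregular.exists_isVelocity {L : Lagrangian I G} (hL : Hyperregular L) :
    ∃ X, IsVelocity L X := by
  obtain ⟨Φ, hΦ⟩ := hL
  let c : G × (E →L[ℝ] ℝ) → CotangentBundle I G :=
    fun p => ⟨p.1, ContinuousLinearMap.comp p.2 (leftMulInv I p.1)⟩
  -- The Legendre transform covers the identity of G, hence so does its inverse.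
  have hfst : ∀ p, (Φ.symm (c p)).1 = p.1 := fun p => by
    have h := hΦ (Φ.symm (c p))
    rw [Φ.apply_symm_apply] at h
    exact (congrArg TotalSpace.proj h).symm
  have hsm : ContMDiff (I.prod 𝓘(ℝ, E →L[ℝ] ℝ)) (I.prod 𝓘(ℝ, E)) ∞
      (fun p => (((Φ.symm (c p)).1, leftMulInv I (Φ.symm (c p)).1 (Φ.symm (c p)).2) : G × E)) :=
    contMDiff_leftMulInv.comp (Φ.symm.contMDiff.comp contMDiff_coMul)
  have hc : ∀ g ξ, c (g, dLagrangian_dξ L g ξ) = Φ ⟨g, leftMul I g ξ⟩ := fun g ξ => by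
    rw [hΦ, legendreTransform, fiberDerivative_eq]
  refine ⟨fun p => leftMulInv I (Φ.symm (c p)).1 (Φ.symm (c p)).2, hsm.snd, fun p => ?_,
    fun g ξ => ?_⟩
  · set X : E := leftMulInv I (Φ.symm (c p)).1 (Φ.symm (c p)).2 with hX
    have h1 : Φ.symm (c p) = ⟨p.1, leftMul I p.1 X⟩ := by
      have h2 : leftMul I (Φ.symm (c p)).1 X = (Φ.symm (c p)).2 := leftMul_leftMulInv _ _
      have h3 : Φ.symm (c p) = ⟨(Φ.symm (c p)).1, leftMul I (Φ.symm (c p)).1 X⟩ := by rw [h2]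
      rw [hfst] at h3
      exact h3
    have h4 : c p = c (p.1, dLagrangian_dξ L p.1 X) := by
      rw [hc, ← h1, Φ.apply_symm_apply]
    have h5 : (ContinuousLinearMap.comp p.2 (leftMulInv I p.1) : TangentSpace I p.1 →L[ℝ] ℝ) =
        ContinuousLinearMap.comp (dLagrangian_dξ L p.1 X) (leftMulInv I p.1) := by
      simpa [c] using h4
    -- Testing on vectors gη cancels the factor g⁻¹ on both covectors.
    refine ContinuousLinearMap.ext fun η => ?_
    have h6 := congrArg (fun A : E →L[ℝ] ℝ => A (leftMul I p.1 η)) h5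
    have h7 : leftMulInv I p.1 (leftMul I p.1 η) = η := leftMulInv_leftMul _ _
    exact ((congrArg (dLagrangian_dξ L p.1 X) h7).symm.trans h6.symm).trans (congrArg p.2 h7)
  · rw [hc, Φ.symm_apply_apply]
    exact leftMulInv_leftMul g ξ


variable (I G) in
/-- The Lie bracket of `G`, on the model space. -/
noncomputable def modelBracket : E → E → E :=
  (fun ξ η => ⁅ξ, η⁆ : GroupLieAlgebra I G → GroupLieAlgebra I G → GroupLieAlgebra I G)

/-- The Lagrangian `ℓ` in the chart at `g₀`. -/
noncomputable def chartLagrangian (L : Lagrangian I G) (g₀ : G) (z : E × E) : ℝ :=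
  leftLagrangian L ((extChartAt I g₀).symm z.1) z.2

variable (I) in
/-- The velocity in the chart at `g₀`. -/
noncomputable def chartVelocity
    (X : G × (E →L[ℝ] ℝ) → E) (g₀ : G) (y : E × (E →L[ℝ] ℝ)) : E :=
  X ((extChartAt I g₀).symm y.1, y.2)

theorem contDiffAt_chartLagrangian [I.Boundaryless] (L : Lagrangian I G) {g₀ : G} {z : E × E}
    (hz : z.1 ∈ (extChartAt I g₀).target) : ContDiffAt ℝ ∞ (chartLagrangian L g₀) z := by
  rw [← contMDiffAt_iff_contDiffAt]
  have h : ContMDiffAt 𝓘(ℝ, E × E) (I.prod 𝓘(ℝ, E)) ∞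
      (fun z : E × E => ((extChartAt I g₀).symm z.1, z.2)) z :=
    ((contMDiffAt_extChartAt_symm hz).comp z contDiff_fst.contMDiff.contMDiffAt).prodMk
      contDiff_snd.contMDiff.contMDiffAt
  exact (contMDiff_leftLagrangian L).contMDiffAt.comp z h

theorem IsVelocity.contDiffAt_chartVelocity [I.Boundaryless] {L : Lagrangian I G}
    {X : G × (E →L[ℝ] ℝ) → E}
    (hX : IsVelocity L X) {g₀ : G} {y : E × (E →L[ℝ] ℝ)}
    (hy : y.1 ∈ (extChartAt I g₀).target) : ContDiffAt ℝ ∞ (chartVelocity I X g₀) y := by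
  rw [← contMDiffAt_iff_contDiffAt]
  have h : ContMDiffAt 𝓘(ℝ, E × (E →L[ℝ] ℝ)) (I.prod 𝓘(ℝ, E →L[ℝ] ℝ)) ∞
      (fun z : E × (E →L[ℝ] ℝ) => ((extChartAt I g₀).symm z.1, z.2)) y :=
    ((contMDiffAt_extChartAt_symm hy).comp y contDiff_fst.contMDiff.contMDiffAt).prodMk
      contDiff_snd.contMDiff.contMDiffAt
  exact hX.smooth.contMDiffAt.comp y h

theorem fderiv_chartLagrangian_inr [I.Boundaryless] (L : Lagrangian I G) {g₀ : G} {z : E × E}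
    (hz : z.1 ∈ (extChartAt I g₀).target) (η : E) :
    fderiv ℝ (chartLagrangian L g₀) z (0, η) =
      dLagrangian_dξ L ((extChartAt I g₀).symm z.1) z.2 η := by
  have h := ((contDiffAt_chartLagrangian L hz).differentiableAt (by simp)).hasFDerivAt
  have h2 : HasFDerivAt (fun ζ : E => chartLagrangian L g₀ (z.1, ζ)) _ z.2 :=
    HasFDerivAt.comp (g := chartLagrangian L g₀) z.2 h (hasFDerivAt_prodMk_right z.1 z.2)
  exact (congrArg (fun A : E →L[ℝ] ℝ => A η) h2.fderiv).symm

/-- Chain rule for h ↦ ℓ(h, ξ), which near g is the coordinate Lagrangian composed with the chart.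
The frame is by definition the coordinate expression of η ↦ gη. -/
theorem dLagrangian_dg_leftMul [I.Boundaryless] (L : Lagrangian I G) {g₀ g : G}
    (hg : g ∈ (extChartAt I g₀).source) (ξ η : E) :
    dLagrangian_dg L g ξ (leftMul I g η) = fderiv ℝ (chartLagrangian L g₀) (extChartAt I g₀ g, ξ)
      (groupFrame I g₀ (extChartAt I g₀ g) η, 0) := by
  have := IsManifold.of_le (I := I) (M := G) (m := 1) (n := ∞) (by simp)
  have hz := (extChartAt I g₀).map_source hg
  have h := ((contDiffAt_chartLagrangian L (z := (extChartAt I g₀ g, ξ)) hz).differentiableAt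
    (by simp)).hasFDerivAt
  have h2 : HasFDerivAt (fun q : E => chartLagrangian L g₀ (q, ξ)) _ (extChartAt I g₀ g) :=
    HasFDerivAt.comp (g := chartLagrangian L g₀) _ h (hasFDerivAt_prodMk_left (extChartAt I g₀ g) ξ)
  have hφ : MDifferentiableAt I 𝓘(ℝ, E) (extChartAt I g₀) g :=
    mdifferentiableAt_extChartAt (by rwa [extChartAt_source] at hg)
  have h3 := modelDeriv_comp h2.differentiableAt.mdifferentiableAt hφ
  rw [modelDeriv_eq_fderiv, h2.fderiv] at h3
  have h4 : modelDeriv I 𝓘(ℝ, ℝ) (fun h : G => leftLagrangian L h ξ) g =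
      modelDeriv I 𝓘(ℝ, ℝ) ((fun q : E => chartLagrangian L g₀ (q, ξ)) ∘ extChartAt I g₀) g := by
    refine modelDeriv_congr ?_
    filter_upwards [(isOpen_extChartAt_source (I := I) g₀).mem_nhds hg] with h hh
    rw [Function.comp_apply, chartLagrangian, (extChartAt I g₀).left_inv hh]
  have h5 := congrArg (fun A : E →L[ℝ] ℝ => A (leftMul I g η)) (h4.trans h3)
  refine h5.trans ?_
  rw [groupFrame, (extChartAt I g₀).left_inv hg]
  rfl

variable [FiniteDimensional ℝ E]

/-- The Hamilton–Pontryagin vector field in the variables `(g, μ)`. -/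
noncomputable def hpField (L : Lagrangian I G) (X : G × (E →L[ℝ] ℝ) → E) (n : G × (E →L[ℝ] ℝ)) :
    TangentSpace (I.prod 𝓘(ℝ, E →L[ℝ] ℝ)) n :=
  ((leftMul I n.1 (X n), coad (I := I) (G := G) (X n) n.2 +
    (dLagrangian_dg L n.1 (X n)).comp (leftMul I n.1)) : E × (E →L[ℝ] ℝ))

/-- The momentum component of the Hamilton–Pontryagin vector field in the chart at `g₀`. -/
noncomputable def chartForce (L : Lagrangian I G) (X : G × (E →L[ℝ] ℝ) → E) (g₀ : G)
    (y : E × (E →L[ℝ] ℝ)) : E →L[ℝ] ℝ :=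
  (show E →L[ℝ] ℝ from coad (I := I) (G := G) (chartVelocity (E := E) I X g₀ y) y.2) +
    ((fderiv ℝ (chartLagrangian L g₀) (y.1, chartVelocity I X g₀ y)).comp
      (ContinuousLinearMap.inl ℝ E E)).comp (groupFrame I g₀ y.1)

theorem chartForce_apply (L : Lagrangian I G) (X : G × (E →L[ℝ] ℝ) → E) {g₀ : G}
    (y : E × (E →L[ℝ] ℝ)) (η : E) :
    chartForce L X g₀ y η =
      y.2 (modelBracket I G (chartVelocity I X g₀ y) η) +
      fderiv ℝ (chartLagrangian L g₀) (y.1, chartVelocity I X g₀ y) (groupFrame I g₀ y.1 η, 0) :=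
  rfl

variable [I.Boundaryless]

theorem groupFrame_modelBracket {g₀ : G} {q : E}
    (hq : q ∈ (extChartAt I g₀).target) (ξ η : E) :
    groupFrame I g₀ q (modelBracket I G ξ η) =
      fderiv ℝ (groupFrame I g₀) q (groupFrame I g₀ q ξ) η -
        fderiv ℝ (groupFrame I g₀) q (groupFrame I g₀ q η) ξ :=
  groupFrame_bracket hq ξ η

/-- The only term whose smoothness is not visible is the bracket. The structure equation replaces it
by B applied to an expression in A and its derivative, all smooth in q. -/
theorem IsVelocity.contDiffAt_chartForce {L : Lagrangian I G} {X : G × (E →L[ℝ] ℝ) → E}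
    (hX : IsVelocity L X) {g₀ : G} {y : E × (E →L[ℝ] ℝ)}
    (hy : y.1 ∈ (extChartAt I g₀).target) : ContDiffAt ℝ ∞ (chartForce L X g₀) y := by
  have ho : IsOpen ((fun y : E × (E →L[ℝ] ℝ) => y.1) ⁻¹' (extChartAt I g₀).target) :=
    (isOpen_extChartAt_target g₀).preimage continuous_fst
  suffices h : ContDiffOn ℝ ∞ (chartForce L X g₀)
      ((fun y : E × (E →L[ℝ] ℝ) => y.1) ⁻¹' (extChartAt I g₀).target) from
    h.contDiffAt (ho.mem_nhds hy)
  rw [contDiffOn_clm_apply]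
  intro η z hz
  refine ContDiffAt.contDiffWithinAt ?_
  have hn := (isOpen_extChartAt_target (I := I) g₀).mem_nhds hz
  have hx := hX.contDiffAt_chartVelocity (g₀ := g₀) hz
  have hA0 := (contDiffOn_groupFrame (I := I) g₀).contDiffAt hn
  have hA : ContDiffAt ℝ ∞ (fun y : E × (E →L[ℝ] ℝ) => groupFrame I g₀ y.1) z :=
    ContDiffAt.comp z hA0 contDiffAt_fst
  have hB : ContDiffAt ℝ ∞ (fun y : E × (E →L[ℝ] ℝ) => groupCoframe I g₀ y.1) z :=
    ContDiffAt.comp z ((contDiffOn_groupCoframe (I := I) g₀).contDiffAt hn) contDiffAt_fst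
  have hDA : ContDiffAt ℝ ∞ (fun y : E × (E →L[ℝ] ℝ) => fderiv ℝ (groupFrame I g₀) y.1) z :=
    ContDiffAt.comp z (hA0.fderiv_right (m := ∞) (by simp)) contDiffAt_fst
  have hDl : ContDiffAt ℝ ∞ (fun y : E × (E →L[ℝ] ℝ) =>
      fderiv ℝ (chartLagrangian L g₀) (y.1, chartVelocity I X g₀ y)) z :=
    ContDiffAt.comp (g := fderiv ℝ (chartLagrangian L g₀)) z
      ((contDiffAt_chartLagrangian L (z := (z.1, chartVelocity I X g₀ z)) hz).fderiv_right
        (m := ∞) (by simp)) (contDiffAt_fst.prodMk hx)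
  have main : ContDiffAt ℝ ∞ (fun y : E × (E →L[ℝ] ℝ) =>
      y.2 (groupCoframe I g₀ y.1 (fderiv ℝ (groupFrame I g₀) y.1
        (groupFrame I g₀ y.1 (chartVelocity I X g₀ y)) η -
        fderiv ℝ (groupFrame I g₀) y.1 (groupFrame I g₀ y.1 η) (chartVelocity I X g₀ y))) +
      fderiv ℝ (chartLagrangian L g₀) (y.1, chartVelocity I X g₀ y)
        (groupFrame I g₀ y.1 η, 0)) z := by
    -- The bracket ⁅ξ, η⁆ is written here as B (DA(Aξ) η - DA(Aη) ξ).
    have hAη := hA.clm_apply (contDiffAt_const (c := η))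
    refine ContDiffAt.add (contDiffAt_snd.clm_apply (hB.clm_apply (ContDiffAt.sub
      ((hDA.clm_apply (hA.clm_apply hx)).clm_apply contDiffAt_const)
      ((hDA.clm_apply hAη).clm_apply hx)))) (hDl.clm_apply (hAη.prodMk contDiffAt_const))
  refine main.congr_of_eventuallyEq ?_
  filter_upwards [ho.mem_nhds hz] with y hy
  have hy' : y.1 ∈ (extChartAt I g₀).target := hy
  have h := groupFrame_modelBracket hy' (chartVelocity I X g₀ y) η
  rw [chartForce_apply, ← h, groupCoframe_groupFrame hy']

theorem chartField_hpField (L : Lagrangian I G) (X : G × (E →L[ℝ] ℝ) → E)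
    {n₀ : G × (E →L[ℝ] ℝ)} {y : E × (E →L[ℝ] ℝ)} (hy : y.1 ∈ (extChartAt I n₀.1).target) :
    chartField (hpField L X) n₀ y =
      (groupFrame I n₀.1 y.1 (chartVelocity I X n₀.1 y), chartForce L X n₀.1 y) := by
  have := IsManifold.of_le (I := I) (M := G) (m := 1) (n := ∞) (by simp)
  have hs := (extChartAt I n₀.1).map_target hy
  refine (modelDeriv_extChartAt_prod_model (n₀ := n₀) (n := ((extChartAt I n₀.1).symm y.1, y.2))
    hs (hpField L X _)).trans ?_
  refine Prod.ext rfl (ContinuousLinearMap.ext fun η => ?_)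
  have h := dLagrangian_dg_leftMul L hs (chartVelocity I X n₀.1 y) η
  rw [(extChartAt I n₀.1).right_inv hy] at h
  exact congrArg (fun r : ℝ =>
    coad (I := I) (G := G) (chartVelocity (E := E) I X n₀.1 y) y.2 η + r) h

theorem IsVelocity.smoothInCharts {L : Lagrangian I G} {X : G × (E →L[ℝ] ℝ) → E}
    (hX : IsVelocity L X) : SmoothInCharts (hpField L X) := by
  intro n₀ y hy
  rw [extChartAt_prod_model_target] at hy ⊢
  have ho : (extChartAt I n₀.1).target ×ˢ univ ∈ nhds y :=
    ((isOpen_extChartAt_target n₀.1).prod isOpen_univ).mem_nhds hy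
  have hA : ContDiffAt ℝ ∞ (fun y : E × (E →L[ℝ] ℝ) => groupFrame I n₀.1 y.1) y :=
    ContDiffAt.comp y ((contDiffOn_groupFrame (I := I) n₀.1).contDiffAt
      ((isOpen_extChartAt_target n₀.1).mem_nhds hy.1)) contDiffAt_fst
  have h := (hA.clm_apply (hX.contDiffAt_chartVelocity hy.1)).prodMk
    (hX.contDiffAt_chartForce hy.1)
  refine (h.congr_of_eventuallyEq ?_).contDiffWithinAt
  filter_upwards [ho] with z hz using chartField_hpField L X hz.1

theorem contDiffAt_coframeOneForm {g₀ : G} {y : E × (E →L[ℝ] ℝ)}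
    (hy : y.1 ∈ (extChartAt I g₀).target) :
    ContDiffAt ℝ ∞ (coframeOneForm (groupCoframe I g₀)) y := by
  have hB : ContDiffAt ℝ ∞ (fun y : E × (E →L[ℝ] ℝ) => groupCoframe I g₀ y.1) y :=
    ContDiffAt.comp y ((contDiffOn_groupCoframe (I := I) g₀).contDiffAt
      ((isOpen_extChartAt_target g₀).mem_nhds hy)) contDiffAt_fst
  exact (contDiffAt_snd.clm_comp hB).clm_comp contDiffAt_const

/-- On the whole chart the Lie derivative of θ = μ(B dq) along the field is the differential of the
Lagrangian at ξ = X(q, μ). An exact Lie derivative of θ forces that of dθ to vanish. -/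
theorem IsVelocity.lieDerivAltZeroAt {L : Lagrangian I G} {X : G × (E →L[ℝ] ℝ) → E}
    (hX : IsVelocity L X) {n₀ : G × (E →L[ℝ] ℝ)} {y : E × (E →L[ℝ] ℝ)}
    (hy : y ∈ (extChartAt (I.prod 𝓘(ℝ, E →L[ℝ] ℝ)) n₀).target) :
    LieDerivAltZeroAt (chartField (hpField L X) n₀)
      (fderiv ℝ (coframeOneForm (groupCoframe I n₀.1))) y := by
  have hn := (isOpen_extChartAt_target (I := I.prod 𝓘(ℝ, E →L[ℝ] ℝ)) n₀).mem_nhds hy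
  have hs := (hX.smoothInCharts n₀).contDiffAt hn
  rw [extChartAt_prod_model_target] at hy hn
  have h2 : (2 : WithTop ℕ∞) ≤ ∞ := WithTop.coe_le_coe.2 le_top
  have hl : ContDiffAt ℝ ∞ (fun z : E × (E →L[ℝ] ℝ) =>
      chartLagrangian L n₀.1 (z.1, chartVelocity I X n₀.1 z)) y :=
    ContDiffAt.comp (g := chartLagrangian L n₀.1) y
      (contDiffAt_chartLagrangian L (z := (y.1, chartVelocity I X n₀.1 y)) hy.1)
      (contDiffAt_fst.prodMk (hX.contDiffAt_chartVelocity hy.1))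
  refine lieDerivAltZeroAt_fderiv (hs.of_le h2) ((contDiffAt_coframeOneForm hy.1).of_le h2)
    (hl.of_le h2) ?_
  -- Each nearby z needs a full neighbourhood inside the target, since the coordinate formula of the
  -- field is differentiated at z.
  filter_upwards [eventually_mem_nhds_iff.2 hn] with z hzn u
  have hz := (mem_of_mem_nhds hzn).1
  have hqn := (isOpen_extChartAt_target (I := I) n₀.1).mem_nhds hz
  have e : fderiv ℝ (chartField (hpField L X) n₀) z = fderiv ℝ (fun z : E × (E →L[ℝ] ℝ) =>
      (groupFrame I n₀.1 z.1 (chartVelocity I X n₀.1 z), chartForce L X n₀.1 z)) z := by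
    refine Filter.EventuallyEq.fderiv_eq ?_
    filter_upwards [hzn] with z' hz' using chartField_hpField L X hz'.1
  rw [e, chartField_hpField L X hz]
  exact lieDeriv_coframeOneForm
    (br := modelBracket I G (chartVelocity I X n₀.1 z))
    (((contDiffOn_groupFrame (I := I) n₀.1).contDiffAt hqn).differentiableAt (by simp))
    (((contDiffOn_groupCoframe (I := I) n₀.1).contDiffAt hqn).differentiableAt (by simp))
    ((hX.contDiffAt_chartVelocity hz).differentiableAt (by simp))
    ((hX.contDiffAt_chartForce hz).differentiableAt (by simp))
    ((contDiffAt_chartLagrangian L hz).differentiableAt (by simp))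
    (groupFrame_groupCoframe hz) (groupCoframe_groupFrame hz)
    (fderiv_groupCoframe_groupFrame hz) (groupFrame_modelBracket hz (chartVelocity I X n₀.1 z))
    (fun η => (fderiv_chartLagrangian_inr L hz η).trans
      (congrArg (fun A : E →L[ℝ] ℝ => A η) (hX.legendre ((extChartAt I n₀.1).symm z.1, z.2))))
    (chartForce_apply L X z) u

end HPField

/-! ### HP solutions as integral curves in the variables (g, μ). -/

section Solutions
variable {E : Type*} [NormedAddCommGroup E] [NormedSpace ℝ E]
  {H : Type*} [TopologicalSpace H] {I : ModelWithCorners ℝ E H}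
  {G : Type*} [TopologicalSpace G] [ChartedSpace H G] [Group G] [LieGroup I ∞ G]

/-- The projection `(g, ξ, μ) ↦ (g, μ)` of the admissible space. -/
def admissibleMomentum (L : Lagrangian I G) (x : admissibleLeft L) : G × (E →L[ℝ] ℝ) :=
  (x.1.1, x.1.2.2)

/-- The section `(g, μ) ↦ (g, X (g, μ), μ)` of `admissibleMomentum`. -/
noncomputable def admissibleOfMomentum (L : Lagrangian I G) (X : G × (E →L[ℝ] ℝ) → E)
    (n : G × (E →L[ℝ] ℝ)) : admissibleLeft L :=
  (admissibleLeftHomeo L).symm (n.1, X n)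

theorem admissibleMomentum_admissibleOfMomentum {L : Lagrangian I G}
    {X : G × (E →L[ℝ] ℝ) → E} (hX : IsVelocity L X) (n : G × (E →L[ℝ] ℝ)) :
    admissibleMomentum L (admissibleOfMomentum L X n) = n :=
  Prod.ext rfl (hX.legendre n)

theorem admissibleOfMomentum_admissibleMomentum {L : Lagrangian I G}
    {X : G × (E →L[ℝ] ℝ) → E} (hX : IsVelocity L X) (x : admissibleLeft L) :
    admissibleOfMomentum L X (admissibleMomentum L x) = x := by
  have h : X (admissibleMomentum L x) = x.1.2.1 := by
    have hx : x.1.2.2 = dLagrangian_dξ L x.1.1 x.1.2.1 := x.2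
    rw [admissibleMomentum, hx, hX.velocity]
  rw [admissibleOfMomentum, h]
  exact (admissibleLeftHomeo L).symm_apply_apply x

theorem contMDiff_admissibleMomentum (L : Lagrangian I G) :
    ContMDiff (I.prod 𝓘(ℝ, E)) (I.prod 𝓘(ℝ, E →L[ℝ] ℝ)) ∞ (admissibleMomentum L) :=
  (contMDiff_admissibleLeft_val L).fst.prodMk (contMDiff_admissibleLeft_val L).snd.snd

theorem IsVelocity.contMDiff_admissibleOfMomentum {L : Lagrangian I G}
    {X : G × (E →L[ℝ] ℝ) → E} (hX : IsVelocity L X) :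
    ContMDiff (I.prod 𝓘(ℝ, E →L[ℝ] ℝ)) (I.prod 𝓘(ℝ, E)) ∞ (admissibleOfMomentum L X) :=
  (contMDiff_transported_symm (I := I.prod 𝓘(ℝ, E)) (admissibleLeftHomeo L)).comp
    (contMDiff_fst.prodMk hX.smooth)

variable [FiniteDimensional ℝ E]

theorem IsVelocity.isMIntegralCurveOn {L : Lagrangian I G} {X : G × (E →L[ℝ] ℝ) → E}
    (hX : IsVelocity L X) {a b : ℝ} {g : ℝ → G} {ξ : ℝ → E} {μ : ℝ → E →L[ℝ] ℝ}
    (h : IsHPSolution L a b g ξ μ) :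
    IsMIntegralCurveOn (fun t => (g t, μ t)) (hpField L X) (Icc a b) := by
  intro t ht
  have hξ : X (g t, μ t) = ξ t := by rw [h.legendre t ht, hX.velocity]
  have h1 := h.reconstruction t ht
  have h2 := (h.momentum t ht).hasFDerivWithinAt.hasMFDerivWithinAt
  rw [← hξ] at h1 h2
  refine (h1.prodMk h2).congr_mfderiv ?_
  have e : ∀ (u : E) (ν : E →L[ℝ] ℝ), ((1 : ℝ →L[ℝ] ℝ).smulRight u).prod
      (ContinuousLinearMap.toSpanSingleton ℝ ν) = (1 : ℝ →L[ℝ] ℝ).smulRight (u, ν) := by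
    intro u ν
    ext <;> simp
  exact e _ _

theorem IsVelocity.isHPSolution {L : Lagrangian I G} {X : G × (E →L[ℝ] ℝ) → E}
    (hX : IsVelocity L X) {a b : ℝ} {γ : ℝ → G × (E →L[ℝ] ℝ)}
    (h : IsMIntegralCurveOn γ (hpField L X) (Icc a b)) :
    IsHPSolution L a b (fun t => (γ t).1) (fun t => X (γ t)) (fun t => (γ t).2) where
  reconstruction t ht := by
    have h1 := (hasMFDerivAt_fst (I := I) (I' := 𝓘(ℝ, E →L[ℝ] ℝ)) (γ t)).comp_hasMFDerivWithinAt t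
      (h t ht)
    refine h1.congr_mfderiv ?_
    have e : ∀ (u : E) (ν : E →L[ℝ] ℝ), (ContinuousLinearMap.fst ℝ E (E →L[ℝ] ℝ)).comp
        ((1 : ℝ →L[ℝ] ℝ).smulRight (u, ν)) = (1 : ℝ →L[ℝ] ℝ).smulRight u := by
      intro u ν
      ext; simp
    exact e _ _
  momentum t ht := by
    have h1 := (hasMFDerivAt_snd (I := I) (I' := 𝓘(ℝ, E →L[ℝ] ℝ)) (γ t)).comp_hasMFDerivWithinAt t
      (h t ht)
    have e : ∀ (u : E) (ν : E →L[ℝ] ℝ), (ContinuousLinearMap.snd ℝ E (E →L[ℝ] ℝ)).comp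
        ((1 : ℝ →L[ℝ] ℝ).smulRight (u, ν)) = ContinuousLinearMap.toSpanSingleton ℝ ν := by
      intro u ν
      ext; simp
    exact hasDerivWithinAt_iff_hasFDerivWithinAt.2
      ((h1.congr_mfderiv (e _ _)).hasFDerivWithinAt)
  legendre t _ := (hX.legendre (γ t)).symm

/-- The reduced field is autonomous, so translating time by a carries [a, b] to [0, b - a]. The
velocity along a solution is recovered as X(g, μ), and admissible points are determined by their (g,
μ). -/
theorem IsVelocity.hpConnects_iff {L : Lagrangian I G} {X : G × (E →L[ℝ] ℝ) → E}
    (hX : IsVelocity L X) {a b : ℝ} {x y : admissibleLeft L} :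
    HPConnects L a b x y ↔
      FlowRel (hpField L X) (b - a) (admissibleMomentum L x) (admissibleMomentum L y) := by
  constructor
  · rintro ⟨g, ξ, μ, h, hx, hy⟩
    refine ⟨fun t => (g (t + a), μ (t + a)), ?_, ?_, ?_⟩
    · simp only [zero_add, admissibleMomentum, ← hx]
    · simp only [sub_add_cancel, admissibleMomentum, ← hy]
    · have h1 := isMIntegralCurveOn_comp_add (dt := a).2 (hX.isMIntegralCurveOn h)
      refine h1.mono fun t ht => ?_
      exact ⟨by linarith [ht.1], by linarith [ht.2]⟩
  · rintro ⟨γ, hx, hy, h⟩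
    have h1 : IsMIntegralCurveOn (γ ∘ (· - a)) (hpField L X) (Icc a b) :=
      (isMIntegralCurveOn_comp_sub (dt := a).2 h).mono fun t ht =>
        ⟨by linarith [ht.1], by linarith [ht.2]⟩
    have key : ∀ z : admissibleLeft L, ((admissibleMomentum L z).1, X (admissibleMomentum L z),
        (admissibleMomentum L z).2) = z.1 := fun z => by
      have hz := congrArg (fun w : admissibleLeft L => w.1.2.1)
        (admissibleOfMomentum_admissibleMomentum hX z)
      exact Prod.ext rfl (Prod.ext hz rfl)
    refine ⟨_, _, _, hX.isHPSolution h1, ?_, ?_⟩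
    · simp only [Function.comp_apply, sub_self, hx, key]
    · simp only [Function.comp_apply, hy, key]

end Solutions

/-! ### Exterior derivatives of one-forms and of pullbacks. -/

section ExteriorDerivative
variable {F : Type*} [NormedAddCommGroup F] [NormedSpace ℝ F]

theorem _root_.DifferentiableAt.ofSubsingleton {θ : F → F →L[ℝ] ℝ} {y : F}
    (hθ : DifferentiableAt ℝ θ y) : DifferentiableAt ℝ
      (fun y => ContinuousAlternatingMap.ofSubsingleton ℝ F ℝ (0 : Fin 1) (θ y)) y :=
  ((ContinuousAlternatingMap.ofSubsingletonLIE (𝕜 := ℝ) (E := F) (F := ℝ)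
    (0 : Fin 1)).toContinuousLinearEquiv.differentiableAt).comp y hθ

theorem extDeriv_ofSubsingleton {θ : F → F →L[ℝ] ℝ} {y : F} (hθ : DifferentiableAt ℝ θ y)
    (w : Fin 2 → F) :
    extDeriv (fun y => ContinuousAlternatingMap.ofSubsingleton ℝ F ℝ (0 : Fin 1) (θ y)) y w =
      fderiv ℝ θ y (w 0) (w 1) - fderiv ℝ θ y (w 1) (w 0) := by
  have h : ∀ u v : F, fderiv ℝ (fun y => θ y u) y v = fderiv ℝ θ y v u := fun u v => by
    rw [(hθ.hasFDerivAt.clm_apply (hasFDerivAt_const u y)).fderiv]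
    simp
  rw [extDeriv_apply hθ.ofSubsingleton, Fin.sum_univ_two]
  simp [Fin.removeNth, Fin.tail, h, sub_eq_add_neg]

variable {HM : Type*} [TopologicalSpace HM] {J : ModelWithCorners ℝ F HM}
  {M : Type*} [TopologicalSpace M] [ChartedSpace HM M] [J.Boundaryless]
  {V : Type*} [NormedAddCommGroup V] [NormedSpace ℝ V]

/-- The exterior derivative of a form which is, in the preferred chart, the pullback of `θ` by a
smooth map `S`. -/
theorem exteriorDerivative_eq_of_pullback {k : ℕ} {α : DiffForm J M k} {x : M}
    {θ : V → V [⋀^Fin k]→L[ℝ] ℝ} {S : F → V}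
    (hS : ContDiffAt ℝ ∞ S (extChartAt J x x))
    (hθ : DifferentiableAt ℝ θ (S (extChartAt J x x)))
    (h : ∀ᶠ y in nhds (extChartAt J x x), ∀ w : Fin k → F,
      (α ((extChartAt J x).symm y) : F [⋀^Fin k]→L[ℝ] ℝ)
        (fun i => modelDeriv 𝓘(ℝ, F) J (extChartAt J x).symm y (w i)) =
      θ (S y) (fun i => fderiv ℝ S y (w i))) (w : Fin (k + 1) → F) :
    (exteriorDerivative J α x : F [⋀^Fin (k + 1)]→L[ℝ] ℝ) w =
      extDeriv θ (S (extChartAt J x x)) (fun i => fderiv ℝ S (extChartAt J x x)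
        (modelDeriv J 𝓘(ℝ, F) (extChartAt J x) x (w i))) := by
  have h2 : minSmoothness ℝ 2 ≤ ∞ := by
    rw [minSmoothness_of_isRCLikeNormedField]
    exact WithTop.coe_le_coe.2 le_top
  have e1 := extDeriv_pullback hθ hS h2
  -- The chart expression of α has the same germ as the pullback of θ by S, and the exterior
  -- derivative at a point depends only on the germ. Naturality under S, in `e1`, concludes.
  have e2 : (fun y : F => ((α ((extChartAt J x).symm y)).compContinuousLinearMap
      (mfderivWithin 𝓘(ℝ, F) J (extChartAt J x).symm (range J) y) : F [⋀^Fin k]→L[ℝ] ℝ))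
      =ᶠ[nhds (extChartAt J x x)]
      fun y => (θ (S y)).compContinuousLinearMap (fderiv ℝ S y) := by
    filter_upwards [h] with y hy
    rw [J.range_eq_univ, mfderivWithin_univ]
    exact ContinuousAlternatingMap.ext hy
  have e3 : extDerivWithin (fun y : F => ((α ((extChartAt J x).symm y)).compContinuousLinearMap
      (mfderivWithin 𝓘(ℝ, F) J (extChartAt J x).symm (range J) y) : F [⋀^Fin k]→L[ℝ] ℝ))
      (range J) (extChartAt J x x) =
      (extDeriv θ (S (extChartAt J x x))).compContinuousLinearMap
        (fderiv ℝ S (extChartAt J x x)) := by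
    rw [e2.extDerivWithin_eq_nhds, J.range_eq_univ, extDerivWithin_univ, e1]
  exact congrArg (fun β : F [⋀^Fin (k + 1)]→L[ℝ] ℝ =>
    β (fun i => modelDeriv J 𝓘(ℝ, F) (extChartAt J x) x (w i))) e3

end ExteriorDerivative

/-! ### The canonical symplectic form in left-trivialized coordinates. -/

section Cotangent
variable {E : Type*} [NormedAddCommGroup E] [NormedSpace ℝ E]
  {H : Type*} [TopologicalSpace H] {I : ModelWithCorners ℝ E H}
  {G : Type*} [TopologicalSpace G] [ChartedSpace H G] [Group G] [LieGroup I ∞ G]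

variable (I G) in
/-- The left trivialization `(g, μ) ↦ (g, g μ)` of the cotangent bundle. -/
noncomputable def cotangentOfMomentum (n : G × (E →L[ℝ] ℝ)) : CotangentBundle I G :=
  ⟨n.1, ContinuousLinearMap.comp n.2 (leftMulInv I n.1)⟩

variable (I G) in
/-- The inverse of the left trivialization of the cotangent bundle. -/
noncomputable def momentumOfCotangent (z : CotangentBundle I G) : G × (E →L[ℝ] ℝ) :=
  (z.1, ContinuousLinearMap.comp z.2 (leftMul I z.1))

theorem momentumOfCotangent_cotangentOfMomentum (n : G × (E →L[ℝ] ℝ)) :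
    momentumOfCotangent I G (cotangentOfMomentum I G n) = n :=
  Prod.ext rfl (ContinuousLinearMap.ext fun η => congrArg n.2 (leftMulInv_leftMul (I := I) n.1 η))

theorem contMDiff_momentumOfCotangent :
    ContMDiff (I.prod 𝓘(ℝ, E →L[ℝ] ℝ)) (I.prod 𝓘(ℝ, E →L[ℝ] ℝ)) ∞
      (momentumOfCotangent I G) := by
  intro z₀
  have hp : ContMDiff (I.prod 𝓘(ℝ, E →L[ℝ] ℝ)) I ∞ (fun z : CotangentBundle I G => z.1) :=
    contMDiff_proj _
  have hϕ := ContMDiffAt.mfderiv (I := I) (I' := I)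
    (J := I.prod 𝓘(ℝ, E →L[ℝ] ℝ)) (m := ∞) (n := ∞) (x₀ := z₀)
    (fun (z : CotangentBundle I G) (h : G) => z.1 * h) (fun _ => 1)
    (((hp.comp contMDiff_fst).mul contMDiff_snd).contMDiffAt) contMDiffAt_const (by simp)
  have e : (fun z : CotangentBundle I G => z.1 * 1) = fun z => z.1 := by ext; simp
  rw [e] at hϕ
  have hid := ((contMDiffAt_hom_bundle _).1 (contMDiffAt_id
    (I := I.prod 𝓘(ℝ, E →L[ℝ] ℝ)) (n := ∞) (x := z₀))).2
  have hc := ContMDiffAt.clm_comp hid hϕ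
  -- In the trivialization at z₀ the fibre part is the coordinate covector composed with the
  -- coordinate form of left multiplication. Inserting the trivialization and its inverse between
  -- the two is harmless only over the base set, hence an eventual equality.
  refine (hp z₀).prodMk (hc.congr_of_eventuallyEq ?_)
  have hb : ∀ᶠ z in nhds z₀, z.1 ∈ (trivializationAt E (TangentSpace I) z₀.1).baseSet :=
    hp.continuous.continuousAt.eventually
      ((trivializationAt E (TangentSpace I) z₀.1).open_baseSet.mem_nhds
        (mem_baseSet_trivializationAt E (TangentSpace I) z₀.1))
  filter_upwards [hb] with z hz
  refine ContinuousLinearMap.ext fun η => ?_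
  simp only [inTangentCoordinates, ContinuousLinearMap.inCoordinates]
  simp only [ContinuousLinearMap.comp_apply]
  -- At its own base point 1 the tangent trivialization acts as the identity, so 𝔤 is not altered by
  -- the passage to coordinates.
  have h1 : ∀ ζ : E, Trivialization.symmL ℝ (trivializationAt E (TangentSpace I) (1 : G)) 1 ζ = ζ :=
    fun ζ => by
      have hm := mem_baseSet_trivializationAt E (TangentSpace I) (1 : G)
      have h3 := (trivializationAt E (TangentSpace I) (1 : G)).symmL_continuousLinearMapAt (R := ℝ)
        hm ζ
      rw [Trivialization.continuousLinearMapAt_apply, Trivialization.coe_linearMapAt_of_mem _ hm]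
        at h3
      exact (congrArg _ (trivializationAt_self_snd 1 ζ).symm).trans h3
  have h2 := (trivializationAt E (TangentSpace I) z₀.1).symmL_continuousLinearMapAt (R := ℝ) hz
  have h3 : ∀ r : ℝ, Trivialization.continuousLinearMapAt ℝ
      (trivializationAt ℝ (fun _ : G => ℝ) z₀.1) z.1 r = r := fun r => by
    rw [Trivialization.continuousLinearMapAt_apply, Trivialization.coe_linearMapAt_of_mem]
    · rfl
    · trivial
  exact ((h3 _).trans (congrArg z.2 ((h2 _).trans (congrArg (leftMul I z.1) (h1 η))))).symm

variable (I G) in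
/-- The pullback of the canonical symplectic form by the left trivialization. -/
noncomputable def momentumTwoForm : DiffForm (I.prod 𝓘(ℝ, E →L[ℝ] ℝ)) (G × (E →L[ℝ] ℝ)) 2 :=
  formPullback (I.prod 𝓘(ℝ, E →L[ℝ] ℝ)) (I.prod 𝓘(ℝ, E →L[ℝ] ℝ)) (cotangentOfMomentum I G)
    (canonicalTwoForm I G)

/-- The two routes into T*G send (g, ξ, μ) to the same point (g, gμ): the projection forgets exactly
the velocity. Apply functoriality of the pullback to both factorizations. -/
theorem symplecticFormLeft_eq_formPullback (L : Lagrangian I G) (x : admissibleLeft L) :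
    symplecticFormLeft L x = formPullback (I.prod 𝓘(ℝ, E)) (I.prod 𝓘(ℝ, E →L[ℝ] ℝ))
      (admissibleMomentum L) (momentumTwoForm I G) x := by
  have hφ : MDifferentiableAt (I.prod 𝓘(ℝ, E)) I.tangent (leftTrivializationRestr L) x :=
    (contMDiff_leftTrivializationRestr L).mdifferentiableAt (by simp)
  have hπ : MDifferentiableAt I.tangent (I.prod 𝓘(ℝ, E →L[ℝ] ℝ)) (piHPRestr L)
      (leftTrivializationRestr L x) :=
    (contMDiff_piHP.comp (contMDiff_admissibleHP_val L)).mdifferentiableAt (by simp)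
  have hΨ : MDifferentiableAt (I.prod 𝓘(ℝ, E →L[ℝ] ℝ)) (I.prod 𝓘(ℝ, E →L[ℝ] ℝ))
      (cotangentOfMomentum I G) (admissibleMomentum L x) :=
    contMDiff_coMul.mdifferentiableAt (by simp)
  have hm : MDifferentiableAt (I.prod 𝓘(ℝ, E)) (I.prod 𝓘(ℝ, E →L[ℝ] ℝ))
      (admissibleMomentum L) x := (contMDiff_admissibleMomentum L).mdifferentiableAt (by simp)
  exact (formPullback_comp (canonicalTwoForm I G) hπ hφ).symm.trans
    (formPullback_comp (canonicalTwoForm I G) hΨ hm)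

variable [I.Boundaryless]

/-- The inverse left trivialization pulls the form `μ (B q dq)` back to the canonical one-form,
along any map into the cotangent bundle. -/
theorem canonicalOneForm_eq_pullback {n₀ : G × (E →L[ℝ] ℝ)}
    {σ : E × (E →L[ℝ] ℝ) → CotangentBundle I G} {y : E × (E →L[ℝ] ℝ)}
    (hσ : MDifferentiableAt 𝓘(ℝ, E × (E →L[ℝ] ℝ)) (I.prod 𝓘(ℝ, E →L[ℝ] ℝ)) σ y)
    (hg : (σ y).1 ∈ (extChartAt I n₀.1).source) (w : Fin 1 → E × (E →L[ℝ] ℝ)) :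
    (canonicalOneForm I G (σ y) : (E × (E →L[ℝ] ℝ)) [⋀^Fin 1]→L[ℝ] ℝ)
      (fun i => modelDeriv 𝓘(ℝ, E × (E →L[ℝ] ℝ)) (I.prod 𝓘(ℝ, E →L[ℝ] ℝ)) σ y (w i)) =
    ContinuousAlternatingMap.ofSubsingleton ℝ (E × (E →L[ℝ] ℝ)) ℝ (0 : Fin 1)
      (coframeOneForm (groupCoframe I n₀.1)
        ((extChartAt (I.prod 𝓘(ℝ, E →L[ℝ] ℝ)) n₀ ∘ momentumOfCotangent I G ∘ σ) y))
      (fun i => fderiv ℝ (extChartAt (I.prod 𝓘(ℝ, E →L[ℝ] ℝ)) n₀ ∘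
        momentumOfCotangent I G ∘ σ) y (w i)) := by
  have := IsManifold.of_le (I := I) (M := G) (m := 1) (n := ∞) (by simp)
  set z' : CotangentBundle I G := σ y
  set S := extChartAt (I.prod 𝓘(ℝ, E →L[ℝ] ℝ)) n₀ ∘ momentumOfCotangent I G ∘ σ
  have hproj : MDifferentiableAt (I.prod 𝓘(ℝ, E →L[ℝ] ℝ)) I
      (TotalSpace.proj : CotangentBundle I G → G) z' :=
    (contMDiff_proj (n := ∞) _).mdifferentiableAt (by simp)
  have hφ : MDifferentiableAt I 𝓘(ℝ, E) (extChartAt I n₀.1) z'.1 :=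
    mdifferentiableAt_extChartAt (by rwa [extChartAt_source] at hg)
  have hS : DifferentiableAt ℝ S y := by
    have h1 : MDifferentiableAt 𝓘(ℝ, E × (E →L[ℝ] ℝ)) 𝓘(ℝ, E × (E →L[ℝ] ℝ)) S y := by
      refine MDifferentiableAt.comp y (mdifferentiableAt_extChartAt ?_) (MDifferentiableAt.comp y
        (contMDiff_momentumOfCotangent.mdifferentiableAt (by simp)) hσ)
      rw [← extChartAt_source (I.prod 𝓘(ℝ, E →L[ℝ] ℝ)), extChartAt_prod_model_source]
      exact ⟨hg, trivial⟩
    exact h1.differentiableAt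
  set u := w 0
  -- Both sides will be p(v), where v is the base velocity of σ in direction u. On the coframe side
  -- B returns g⁻¹v while the momentum is p composed with left multiplication by g, and the
  -- translations cancel.
  set v : E := modelDeriv 𝓘(ℝ, E × (E →L[ℝ] ℝ)) I
    ((TotalSpace.proj : CotangentBundle I G → G) ∘ σ) y u
  have hv1 : modelDeriv (I.prod 𝓘(ℝ, E →L[ℝ] ℝ)) I (TotalSpace.proj : CotangentBundle I G → G) z'
      (modelDeriv 𝓘(ℝ, E × (E →L[ℝ] ℝ)) (I.prod 𝓘(ℝ, E →L[ℝ] ℝ)) σ y u) = v :=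
    (congrArg (fun A : E × (E →L[ℝ] ℝ) →L[ℝ] E => A u) (modelDeriv_comp (f := σ)
      (g := (TotalSpace.proj : CotangentBundle I G → G)) hproj hσ)).symm
  have hv2 : (fderiv ℝ S y u).1 = modelDeriv I 𝓘(ℝ, E) (extChartAt I n₀.1) z'.1 v := by
    have h1 := modelDeriv_comp (f := (TotalSpace.proj : CotangentBundle I G → G) ∘ σ)
      (g := extChartAt I n₀.1) hφ (hproj.comp y hσ)
    have h2 : HasFDerivAt (fun y => (S y).1)
      ((ContinuousLinearMap.fst ℝ E (E →L[ℝ] ℝ)).comp (fderiv ℝ S y)) y :=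
      hasFDerivAt_fst.comp y hS.hasFDerivAt
    have h3 : modelDeriv 𝓘(ℝ, E × (E →L[ℝ] ℝ)) 𝓘(ℝ, E) (fun y => (S y).1) y = _ :=
      modelDeriv_eq_fderiv.trans h2.fderiv
    exact congrArg (fun A : E × (E →L[ℝ] ℝ) →L[ℝ] E => A u) (h3.symm.trans h1)
  have hA : groupFrame I n₀.1 (extChartAt I n₀.1 z'.1) (leftMulInvModel I z'.1 v) =
      modelDeriv I 𝓘(ℝ, E) (extChartAt I n₀.1) z'.1 v := by
    rw [groupFrame, (extChartAt I n₀.1).left_inv hg]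
    exact congrArg (modelDeriv I 𝓘(ℝ, E) (extChartAt I n₀.1) z'.1)
      (leftMul_leftMulInv (I := I) z'.1 v)
  have hB : groupCoframe I n₀.1 (S y).1 (fderiv ℝ S y u).1 = leftMulInvModel I z'.1 v := by
    rw [hv2, ← hA]
    exact groupCoframe_groupFrame ((extChartAt I n₀.1).map_source hg) _
  let p : E →L[ℝ] ℝ := z'.2
  have hR : coframeOneForm (groupCoframe I n₀.1) (S y) (fderiv ℝ S y u) = p v := by
    rw [coframeOneForm_apply, hB]
    exact congrArg p (leftMul_leftMulInv (I := I) z'.1 v)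
  exact (congrArg p hv1).trans hR.symm

variable [FiniteDimensional ℝ E]

/-- The canonical form is differentiated in the preferred chart e of T*G at the image of n, whereas
the claim concerns the product chart c at n₀. The two are linked by S, the change of coordinates
from e to c through the inverse left trivialization. In the chart e, Θ is the pullback of θ by S, so
dΘ is the pullback of dθ. -/
theorem momentumTwoForm_apply {n₀ n : G × (E →L[ℝ] ℝ)}
    (hn : n ∈ (extChartAt (I.prod 𝓘(ℝ, E →L[ℝ] ℝ)) n₀).source) (w : Fin 2 → E × (E →L[ℝ] ℝ)) :
    let g := fderiv ℝ (coframeOneForm (groupCoframe I n₀.1))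
      (extChartAt (I.prod 𝓘(ℝ, E →L[ℝ] ℝ)) n₀ n)
    let D := modelDeriv (I.prod 𝓘(ℝ, E →L[ℝ] ℝ)) 𝓘(ℝ, E × (E →L[ℝ] ℝ))
      (extChartAt (I.prod 𝓘(ℝ, E →L[ℝ] ℝ)) n₀) n
    (momentumTwoForm I G n : (E × (E →L[ℝ] ℝ)) [⋀^Fin 2]→L[ℝ] ℝ) w =
      g (D (w 0)) (D (w 1)) - g (D (w 1)) (D (w 0)) := by
  intro g D
  have : IsManifold (I.prod 𝓘(ℝ, E →L[ℝ] ℝ)) 1 (CotangentBundle I G) :=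
    IsManifold.of_le (n := ∞) (by simp)
  set c := extChartAt (I.prod 𝓘(ℝ, E →L[ℝ] ℝ)) n₀ with hc
  set z := cotangentOfMomentum I G n with hz
  set e := extChartAt (I.prod 𝓘(ℝ, E →L[ℝ] ℝ)) z with he
  set S := c ∘ momentumOfCotangent I G ∘ e.symm with hSdef
  have hez : e.symm (e z) = z := extChartAt_to_inv z
  have hmz : momentumOfCotangent I G z = n := momentumOfCotangent_cotangentOfMomentum n
  have hSz : S (e z) = c n := by
    rw [hSdef, Function.comp_apply, Function.comp_apply, hez, hmz]
  have hcn : ContMDiffAt (I.prod 𝓘(ℝ, E →L[ℝ] ℝ)) 𝓘(ℝ, E × (E →L[ℝ] ℝ)) ∞ c n :=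
    contMDiffAt_extChartAt' (by rwa [hc, extChartAt_source] at hn)
  have hesymm : ∀ y ∈ e.target, ContMDiffAt 𝓘(ℝ, E × (E →L[ℝ] ℝ)) (I.prod 𝓘(ℝ, E →L[ℝ] ℝ)) ∞
      e.symm y := fun y hy =>
    (contMDiffOn_extChartAt_symm z).contMDiffAt ((isOpen_extChartAt_target z).mem_nhds hy)
  have htz : e z ∈ e.target := mem_extChartAt_target z
  have hSM : ContMDiffAt 𝓘(ℝ, E × (E →L[ℝ] ℝ)) 𝓘(ℝ, E × (E →L[ℝ] ℝ)) ∞ S (e z) := by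
    have h1 : ContMDiffAt 𝓘(ℝ, E × (E →L[ℝ] ℝ)) (I.prod 𝓘(ℝ, E →L[ℝ] ℝ)) ∞
        (momentumOfCotangent I G ∘ e.symm) (e z) :=
      contMDiff_momentumOfCotangent.contMDiffAt.comp (e z) (hesymm _ htz)
    refine ContMDiffAt.comp (e z) ?_ h1
    rwa [Function.comp_apply, hez, hmz]
  have hS : ContDiffAt ℝ ∞ S (e z) := contMDiffAt_iff_contDiffAt.1 hSM
  have hn1 : n.1 ∈ (extChartAt I n₀.1).source := by
    rw [hc, extChartAt_prod_model_source] at hn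
    exact hn.1
  have hd : DifferentiableAt ℝ (coframeOneForm (groupCoframe I n₀.1)) (c n) :=
    (contDiffAt_coframeOneForm (g₀ := n₀.1)
      ((extChartAt I n₀.1).map_source hn1 : (c n).1 ∈ _)).differentiableAt (by simp)
  have hθ : DifferentiableAt ℝ (fun y => ContinuousAlternatingMap.ofSubsingleton ℝ
      (E × (E →L[ℝ] ℝ)) ℝ (0 : Fin 1) (coframeOneForm (groupCoframe I n₀.1) y)) (S (e z)) := by
    rw [hSz]
    exact hd.ofSubsingleton
  have hev : ∀ᶠ y in nhds (e z), y ∈ e.target ∧ (e.symm y).1 ∈ (extChartAt I n₀.1).source := by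
    refine Filter.inter_mem (extChartAt_target_mem_nhds z) ?_
    have h1 : ContinuousAt (fun y => (e.symm y).1) (e z) :=
      (FiberBundle.continuous_proj _ _).continuousAt.comp (hesymm _ htz).continuousAt
    refine h1 ((isOpen_extChartAt_source n₀.1).mem_nhds ?_)
    have h2 : (e.symm (e z)).1 = n.1 := congrArg TotalSpace.proj hez
    exact (congrArg (· ∈ (extChartAt I n₀.1).source) h2).mpr hn1
  have main := exteriorDerivative_eq_of_pullback (J := I.prod 𝓘(ℝ, E →L[ℝ] ℝ))
    (α := canonicalOneForm I G) (x := z) hS hθ (by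
      filter_upwards [hev] with y hy w
      exact canonicalOneForm_eq_pullback ((hesymm y hy.1).mdifferentiableAt (by simp)) hy.2 w)
    (fun i => modelDeriv (I.prod 𝓘(ℝ, E →L[ℝ] ℝ)) (I.prod 𝓘(ℝ, E →L[ℝ] ℝ))
      (cotangentOfMomentum I G) n (w i))
  -- Near n, following the left trivialization by e and then S gives back c, so the three
  -- derivatives compose to that of c.
  have hD : ∀ u : E × (E →L[ℝ] ℝ), fderiv ℝ S (e z) (modelDeriv (I.prod 𝓘(ℝ, E →L[ℝ] ℝ))
      𝓘(ℝ, E × (E →L[ℝ] ℝ)) e z (modelDeriv (I.prod 𝓘(ℝ, E →L[ℝ] ℝ)) (I.prod 𝓘(ℝ, E →L[ℝ] ℝ))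
      (cotangentOfMomentum I G) n u)) = D u := fun u => by
    have hΨ : MDifferentiableAt (I.prod 𝓘(ℝ, E →L[ℝ] ℝ)) (I.prod 𝓘(ℝ, E →L[ℝ] ℝ))
        (cotangentOfMomentum I G) n := contMDiff_coMul.mdifferentiableAt (by simp)
    have he1 : MDifferentiableAt (I.prod 𝓘(ℝ, E →L[ℝ] ℝ)) 𝓘(ℝ, E × (E →L[ℝ] ℝ)) e z :=
      mdifferentiableAt_extChartAt (mem_chart_source _ z)
    have h1 := modelDeriv_comp (f := cotangentOfMomentum I G) (g := e) he1 hΨ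
    have h2 := modelDeriv_comp (f := e ∘ cotangentOfMomentum I G) (g := S)
      (hSM.mdifferentiableAt (by simp)) (he1.comp n hΨ)
    have h3 : c =ᶠ[nhds n] S ∘ (e ∘ cotangentOfMomentum I G) := by
      filter_upwards [hΨ.continuousAt (extChartAt_source_mem_nhds (I := I.prod 𝓘(ℝ, E →L[ℝ] ℝ)) z)]
        with n' hn'
      have h4 : e.symm (e (cotangentOfMomentum I G n')) = cotangentOfMomentum I G n' :=
        e.left_inv hn'
      simp only [hSdef, Function.comp_apply]
      rw [h4, momentumOfCotangent_cotangentOfMomentum]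
    have h5 := (modelDeriv_congr (J := I.prod 𝓘(ℝ, E →L[ℝ] ℝ))
      (J' := 𝓘(ℝ, E × (E →L[ℝ] ℝ))) h3).trans h2
    rw [h1, modelDeriv_eq_fderiv] at h5
    exact (congrArg (fun A : E × (E →L[ℝ] ℝ) →L[ℝ] E × (E →L[ℝ] ℝ) => A u) h5).symm
  rw [hSz] at main
  refine (main.trans (extDeriv_ofSubsingleton hd _)).trans ?_
  rw [hD, hD]

theorem IsVelocity.invariantInCharts {L : Lagrangian I G} {X : G × (E →L[ℝ] ℝ) → E}
    (hX : IsVelocity L X) : InvariantInCharts (hpField L X) (momentumTwoForm I G) := by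
  intro n₀
  refine ⟨fderiv ℝ (coframeOneForm (groupCoframe I n₀.1)), fun y hy => ?_,
    fun y hy => hX.lieDerivAltZeroAt hy, fun n hn w => momentumTwoForm_apply hn w⟩
  rw [extChartAt_prod_model_target] at hy
  exact ((contDiffAt_coframeOneForm hy.1).fderiv_right (m := ∞)
    (by simp)).differentiableAt (by simp)

end Cotangent

end HPFlow

/-! ### The theorem: transfer from G × 𝔤* back to the admissible space. -/

open HPFlow
theorem mainTheorem2
    {E : Type*} [NormedAddCommGroup E] [NormedSpace ℝ E] [FiniteDimensional ℝ E]
    {H : Type*} [TopologicalSpace H] (I : ModelWithCorners ℝ E H) [I.Boundaryless]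
    {G : Type*} [TopologicalSpace G] [T2Space G] [ChartedSpace H G] [Group G] [LieGroup I ∞ G]
    (L : Lagrangian I G) (hL : Hyperregular L) (a b : ℝ) (hab : a ≤ b) :
    (∀ x y : admissibleLeft L, HPConnects L a b x y → flowMap L a b x = y) ∧
    IsOpen (flowDomain L a b) ∧
    ∀ x ∈ flowDomain L a b,
      MDifferentiableAt (I.prod 𝓘(ℝ, E)) (I.prod 𝓘(ℝ, E)) (flowMap L a b) x ∧
      formPullback (I.prod 𝓘(ℝ, E)) (I.prod 𝓘(ℝ, E)) (flowMap L a b) (symplecticFormLeft L) x =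
        symplecticFormLeft L x := by
  obtain ⟨X, hX⟩ := hL.exists_isVelocity
  have : CompleteSpace E := FiniteDimensional.complete ℝ E
  have : IsManifold I 1 G := IsManifold.of_le (n := ∞) (by simp)
  have hs : 0 ≤ b - a := sub_nonneg.2 hab
  have hunique : ∀ x y : admissibleLeft L, HPConnects L a b x y → flowMap L a b x = y := by
    intro x y hxy
    have hex : ∃ y, HPConnects L a b x y := ⟨y, hxy⟩
    have h1 : HPConnects L a b x (flowMap L a b x) := by
      rw [flowMap, dif_pos hex]
      exact hex.choose_spec
    -- The endpoint chosen in `flowMap` and the given y have the same (g, μ) by uniqueness of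
    -- integral curves, and (g, μ) determines an admissible point.
    have h2 := FlowRel.unique hX.smoothInCharts hs (hX.hpConnects_iff.1 h1)
      (hX.hpConnects_iff.1 hxy)
    rw [← admissibleOfMomentum_admissibleMomentum hX (flowMap L a b x), h2,
      admissibleOfMomentum_admissibleMomentum hX]
  have hlocal : ∀ x ∈ flowDomain L a b, ∃ Φ : G × (E →L[ℝ] ℝ) → G × (E →L[ℝ] ℝ),
      (∀ᶠ x' in nhds x, HPConnects L a b x'
        (admissibleOfMomentum L X (Φ (admissibleMomentum L x')))) ∧
      MDifferentiableAt (I.prod 𝓘(ℝ, E →L[ℝ] ℝ)) (I.prod 𝓘(ℝ, E →L[ℝ] ℝ)) Φ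
        (admissibleMomentum L x) ∧
      formPullback (I.prod 𝓘(ℝ, E →L[ℝ] ℝ)) (I.prod 𝓘(ℝ, E →L[ℝ] ℝ)) Φ (momentumTwoForm I G)
        (admissibleMomentum L x) = momentumTwoForm I G (admissibleMomentum L x) := by
    rintro x ⟨y, hxy⟩
    obtain ⟨Φ, hΦ, hd, hω⟩ := FlowRel.flowPreservesAt hX.smoothInCharts hX.invariantInCharts hs
      (hX.hpConnects_iff.1 hxy)
    refine ⟨Φ, ?_, hd, hω⟩
    filter_upwards [(contMDiff_admissibleMomentum L).continuous.continuousAt.eventually hΦ]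
      with x' hx'
    rw [hX.hpConnects_iff, admissibleMomentum_admissibleOfMomentum hX]
    exact hx'
  refine ⟨hunique, isOpen_iff_mem_nhds.2 fun x hx => ?_, fun x hx => ?_⟩
  · obtain ⟨Φ, hΦ, -⟩ := hlocal x hx
    filter_upwards [hΦ] with x' hx' using ⟨_, hx'⟩
  · obtain ⟨Φ, hΦ, hd, hω⟩ := hlocal x hx
    have hm : MDifferentiableAt (I.prod 𝓘(ℝ, E)) (I.prod 𝓘(ℝ, E →L[ℝ] ℝ))
        (admissibleMomentum L) x := (contMDiff_admissibleMomentum L).mdifferentiableAt (by simp)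
    have hK : MDifferentiableAt (I.prod 𝓘(ℝ, E →L[ℝ] ℝ)) (I.prod 𝓘(ℝ, E))
        (admissibleOfMomentum L X) (Φ (admissibleMomentum L x)) :=
      hX.contMDiff_admissibleOfMomentum.mdifferentiableAt (by simp)
    have heq : flowMap L a b =ᶠ[nhds x]
        admissibleOfMomentum L X ∘ (Φ ∘ admissibleMomentum L) := by
      filter_upwards [hΦ] with x' hx' using hunique x' _ hx'
    have hF : MDifferentiableAt (I.prod 𝓘(ℝ, E)) (I.prod 𝓘(ℝ, E)) (flowMap L a b) x :=
      (hK.comp x (hd.comp x hm)).congr_of_eventuallyEq heq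
    refine ⟨hF, ?_⟩
    have hm' : MDifferentiableAt (I.prod 𝓘(ℝ, E)) (I.prod 𝓘(ℝ, E →L[ℝ] ℝ))
        (admissibleMomentum L) (flowMap L a b x) :=
      (contMDiff_admissibleMomentum L).mdifferentiableAt (by simp)
    -- With m the projection to (g, μ), F the flow map and σ the form `momentumTwoForm`, near x one
    -- has m ∘ F = Φ ∘ m. Hence at x, F*(m*σ) = m*(Φ*σ) = m*σ.
    have e1 : admissibleMomentum L ∘ flowMap L a b =ᶠ[nhds x] Φ ∘ admissibleMomentum L := by
      filter_upwards [heq] with x' hx'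
      rw [Function.comp_apply, hx']
      exact admissibleMomentum_admissibleOfMomentum hX _
    have e2 : symplecticFormLeft L = formPullback (I.prod 𝓘(ℝ, E)) (I.prod 𝓘(ℝ, E →L[ℝ] ℝ))
        (admissibleMomentum L) (momentumTwoForm I G) :=
      funext (symplecticFormLeft_eq_formPullback L)
    have e3 := formPullback_comp (momentumTwoForm I G) hm' hF
    have e4 := formPullback_comp (momentumTwoForm I G) hd hm
    have e5 := formPullback_congr (J := I.prod 𝓘(ℝ, E)) (J' := I.prod 𝓘(ℝ, E →L[ℝ] ℝ))
      (momentumTwoForm I G) e1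
    rw [hω] at e4
    rw [e2]
    exact (e3.symm.trans e5).trans e4
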